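/- **Theorem 1.6 (Generic SQ lower bound, real-valued case).** Write $\mathcal N_k$ for the standard Gaussian on $\mathbb R^k$. For every $0<a<1/2$ and $0<\kappa<1$ there are constants $c,c_1,c_2>0$ and $n_0$, depending only on $a$ and $\kappa$, such that the following holds for all integers $n\ge n_0$, $n,m\ge 1$ with $m\le n^a$, and all $\epsilon\ge n^{-c}$. Let $f:\mathbb R^m\to\mathbb R$ satisfy $\mathbf E_{x\sim\mathcal N_m}[f(x)^2]=1$, and let $d$ be the smallest integer $d\ge 0$ such that some polynomial $p:\mathbb R^m\to\mathbb R$ of degree at most $d$ satisfies $\mathbf E_{x\sim\mathcal N_m}|f(x)-p(x)|<\epsilon$. Let $\mathcal C$ be a class of real-valued functions on $\mathbb R^n$ which contains $x\mapsto f(Px)$ for every $P\in\mathbb R^{m\times n}$ with $PP^\top=I_m$. Let $Y\subseteq\mathbb R$ be a set of labels that contains the interval $\left[-\frac1{(1-\kappa)\epsilon},\frac1{(1-\kappa)\epsilon}\right]$ (for example $Y=\mathbb R$). For a distribution $D$ of labelled examples $(x,y)$ on $\mathbb R^n\times\mathbb R$, a statistical query is a function $q:\mathbb R^n\times\mathbb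 R\to[-1,1]$, and a $\mathrm{STAT}(\tau)$ oracle for $D$ answers each query $q$ by some $v$ with $|v-\mathbf E_D[q(x,y)]|\le\tau$. An SQ algorithm adaptively asks finitely many queries and then outputs a hypothesis $h:\mathbb R^n\to\mathbb R$; it may be randomized. Suppose that an SQ algorithm with access to $\mathrm{STAT}(\tau)$, $0<\tau\le 1$, agnostically learns $\mathcal C$ to $L^2$-error $\mathrm{OPT}+\kappa\epsilon$: for every distribution $D$ on $\mathbb R^n\times\mathbb R$ with $x$-marginal $\mathcal N_n$ and with labels in $Y$, and for every $\mathrm{STAT}(\tau)$ oracle for $D$, with probability at least $2/3$ over the randomness of the algorithm its output $h$ satisfies $$\mathbf E_D[(h(x)-y)^2]^{1/2}\le \mathrm{OPT}+\kappa\epsilon,\qquad \mathrm{OPT}=\inf_{F\in\mathcal C}\mathbf E_D[(F(x)-y)^2]^{1/2}.$$ Then either $\tau\le n^{-c_1\min(d,\,n^{c_2})}$ (so $\tau\le n^{-c_1 d}$ whenever $d\le n^{c_2}$), or the algorithm makes at least $2^{n^{c_2}}$ queries in the worst case (over such $D$, oracles for $D$, and the randomness of the algorithm). -/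

import Mathlib

open MeasureTheory ProbabilityTheory
open scoped ENNReal Matrix

noncomputable section

/-- The standard Gaussian measure on `ℝⁿ` (a product of standard univariate Gaussians). -/
def gaussN (n : ℕ) : Measure (Fin n → ℝ) :=
  Measure.pi fun _ => gaussianReal 0 1

/-- Some polynomial of (total) degree at most `k` is at `L¹`-distance less than `ε` from `f` under
the standard Gaussian. -/
def HasL1Approx {m : ℕ} (f : (Fin m → ℝ) → ℝ) (ε : ℝ) (k : ℕ) : Prop :=
  ∃ p : MvPolynomial (Fin m) ℝ, p.totalDegree ≤ k ∧
    eLpNorm (fun x => f x - MvPolynomial.eval x p) 1 (gaussN m) < ENNReal.ofReal ε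

/-- A statistical query on labelled examples from `X × ℝ`: a measurable function into `[-1, 1]`. -/
structure StatQuery (X : Type*) [MeasurableSpace X] where
  toFun : X × ℝ → ℝ
  measurable : Measurable toFun
  bounded : ∀ z, |toFun z| ≤ 1

/-- `O` is a valid `STAT(τ)` oracle for the distribution `D`: its answer to every query is within
`τ` of the expectation of the query. -/
def IsStatOracle {X : Type*} [MeasurableSpace X] (D : Measure (X × ℝ)) (τ : ℝ)
    (O : StatQuery X → ℝ) : Prop :=
  ∀ q : StatQuery X, |O q - ∫ z, q.toFun z ∂D| ≤ τ

/-- A deterministic adaptive statistical query procedure: either it stops and outputs a measurable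
hypothesis, or it asks a query and goes on depending on the answer. -/
inductive SQProc (X : Type*) [MeasurableSpace X]
  | output (h : X → ℝ) (hh : Measurable h) : SQProc X
  | ask (q : StatQuery X) (next : ℝ → SQProc X) : SQProc X

/-- The hypothesis that the procedure outputs when its queries are answered by `O`. -/
def SQProc.run {X : Type*} [MeasurableSpace X] (O : StatQuery X → ℝ) : SQProc X → X → ℝ
  | .output h _ => h
  | .ask q next => (next (O q)).run O

/-- The number of queries that the procedure asks when its queries are answered by `O`. -/
def SQProc.numQueries {X : Type*} [MeasurableSpace X] (O : StatQuery X → ℝ) : SQProc X → ℕ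
  | .output _ _ => 0
  | .ask q next => (next (O q)).numQueries O + 1

/-- The error `E_{(x,y) ∼ D}[(h(x) - y)²]^{1/2}`, with value `∞` when it is infinite. -/
def l2Err {X : Type*} [MeasurableSpace X] (D : Measure (X × ℝ)) (h : X → ℝ) : ℝ≥0∞ :=
  eLpNorm (fun z => h z.1 - z.2) 2 D

/-- The least `L²`-error of the concept class `C`. -/
def l2Opt {X : Type*} [MeasurableSpace X] (D : Measure (X × ℝ)) (C : Set (X → ℝ)) : ℝ≥0∞ :=
  ⨅ F ∈ C, l2Err D F

/-- A distribution of labelled examples on `ℝⁿ × ℝ` with standard Gaussian marginal on `ℝⁿ` and with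
labels in `Y`. There is no other condition on the labels. -/
structure IsGaussianExamples {n : ℕ} (Y : Set ℝ) (D : Measure ((Fin n → ℝ) × ℝ)) : Prop where
  prob : IsProbabilityMeasure D
  marginal : D.map Prod.fst = gaussN n
  labels : ∀ᵐ z ∂D, z.2 ∈ Y

/-- The randomized SQ algorithm `A`, whose random seed has law `ν`, agnostically learns `C` under
the standard Gaussian, for labels in `Y`, to `L²`-error `OPT + η` with access to `STAT(τ)`: for every
distribution of examples and every valid oracle for it, the algorithm fails with probability at most
`1/3` over its seed. (Failure sets are measured by the outer measure.) -/
def AgnosticallyLearns {n : ℕ} {Ω : Type*} [MeasurableSpace Ω] (ν : Measure Ω)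
    (A : Ω → SQProc (Fin n → ℝ)) (C : Set ((Fin n → ℝ) → ℝ)) (Y : Set ℝ) (η τ : ℝ) : Prop :=
  ∀ D : Measure ((Fin n → ℝ) × ℝ), IsGaussianExamples Y D →
    ∀ O : StatQuery (Fin n → ℝ) → ℝ, IsStatOracle D τ O →
      ν {ω | ¬ l2Err D ((A ω).run O) ≤ l2Opt D C + ENNReal.ofReal η} ≤ 1 / 3

/-- In the worst case over examples with labels in `Y`, valid `STAT(τ)` oracles and seeds, the
algorithm `A` makes at least `N` queries. -/
def MakesQueries {n : ℕ} {Ω : Type*} (A : Ω → SQProc (Fin n → ℝ)) (Y : Set ℝ) (τ N : ℝ) : Prop :=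
  ∃ D : Measure ((Fin n → ℝ) × ℝ), IsGaussianExamples Y D ∧
    ∃ O : StatQuery (Fin n → ℝ) → ℝ, IsStatOracle D τ O ∧
      ∃ ω, N ≤ ((A ω).numQueries O : ℝ)

end

/-! The hard instances hide a direction. Since `f` is at `L¹`-distance at least `ε` from every
polynomial of degree below `d`, duality gives a function `g`, bounded by one and orthogonal to these
polynomials, with `∫ f g ≥ ε` (`exists_bounded_annihilator`). For a projection `P`, let the label be
`±B` with conditional mean `B g(Px)`, where `B = 1/((1-κ)ε)`; the reference distribution has `±B`
labels that are pure noise.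

If `P Qᵀ = ρ I`, then `E[g(Px) g(Qx)]` is the quadratic form at `g` of a symmetric operator that
maps a polynomial of degree `k` to `ρ^k` times itself plus lower terms. It therefore acts as `ρ^k`
on the `k`-th orthogonal layer of the degree filtration, and the correlation is at most `ρ^d`
(`abs_integral_mul_mulVec_le`). No Hermite basis is needed. Reed–Solomon codes supply a huge family
of projections for which `ρ` is polynomially small (`exists_nearly_orthogonal_projections`), so the
functions `g(Px)` are nearly orthogonal in `L²`.

A vector correlates noticeably with only few members of a nearly orthogonal family
(`card_le_of_nearly_orthogonal`). This is used twice. A query separates an instance from the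
reference only if its odd part in the label correlates with `g(Px)`. A hypothesis with error `OPT +
κε` must itself correlate with `g(Px)`, because the concept `f(Px)` does
(`correlation_of_l2Err_le`). An oracle that gives the reference answer whenever this is legal thus
makes an algorithm with few queries return the same hypothesis on most instances, and that
hypothesis suits few of them; averaging over the seed contradicts the success probability
(`makesQueries_of_agnosticallyLearns`). -/

/-! ### Gaussian vectors and the joint law of two projections -/

instance isProbabilityMeasure_gaussN (n : ℕ) : IsProbabilityMeasure (gaussN n) := by
  unfold gaussN; infer_instance

theorem charFunDual_gaussN {n : ℕ} (L : StrongDual ℝ (Fin n → ℝ)) :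
    charFunDual (gaussN n) L = Complex.exp (-((∑ i, L (Pi.single i 1) ^ 2 : ℝ) : ℂ) / 2) := by
  have key : ∀ L' : StrongDual ℝ ℝ, charFunDual (gaussianReal 0 1) L'
      = Complex.exp (-((L' 1 ^ 2 : ℝ) : ℂ) / 2) := by
    intro L'
    have : charFunDual (gaussianReal 0 1) L' = charFun (gaussianReal 0 1) (L' 1) := by
      rw [charFunDual_apply, charFun_apply_real]
      congr 1; ext v
      have : L' v = v * L' 1 := by
        rw [← smul_eq_mul, ← map_smul]; simp
      rw [this]; push_cast; ring_nf
    rw [this, charFun_gaussianReal]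
    congr 1; push_cast; ring
  rw [gaussN, charFunDual_pi]
  simp_rw [key]
  rw [← Complex.exp_sum]
  congr 1
  rw [← Finset.sum_div, Finset.sum_neg_distrib]
  push_cast
  rfl

theorem map_dual_gaussN {n : ℕ} (L : StrongDual ℝ (Fin n → ℝ)) :
    (gaussN n).map L = gaussianReal 0 (∑ i, L (Pi.single i 1) ^ 2).toNNReal := by
  have : IsProbabilityMeasure ((gaussN n).map L) :=
    Measure.isProbabilityMeasure_map (by fun_prop)
  refine Measure.ext_of_charFun (funext fun t => ?_)
  rw [charFun_map_eq_charFunDual_smul, charFunDual_gaussN, charFun_gaussianReal,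
    Real.coe_toNNReal _ (by positivity)]
  congr 1
  simp only [_root_.smul_apply, smul_eq_mul, mul_pow, ← Finset.mul_sum]
  push_cast
  ring

theorem apply_mulVec_eq {m n : ℕ} (P : Matrix (Fin m) (Fin n) ℝ)
    (L : StrongDual ℝ (Fin m → ℝ)) (j : Fin n) :
    L (P *ᵥ Pi.single j 1) = ((fun i => L (Pi.single i 1)) ᵥ* P) j := by
  have h : P *ᵥ Pi.single j 1 = ∑ i, P i j • (Pi.single i (1 : ℝ) : Fin m → ℝ) := by
    ext k
    simp [Finset.sum_apply, Pi.single_apply]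
  rw [h, map_sum]
  simp [Matrix.vecMul, dotProduct, mul_comm]

/-- The law of `(X, ρ X + √(1 - ρ²) Z)` for independent standard Gaussian vectors `X`, `Z`. -/
theorem map_mulVec_prod_gaussN {m n : ℕ} {P Q : Matrix (Fin m) (Fin n) ℝ} {ρ c : ℝ}
    (hP : P * Pᵀ = 1) (hQ : Q * Qᵀ = 1) (hPQ : P * Qᵀ = ρ • (1 : Matrix (Fin m) (Fin m) ℝ))
    (hc : ρ ^ 2 + c ^ 2 = 1) :
    (gaussN n).map (fun x => (P *ᵥ x, Q *ᵥ x)) =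
      ((gaussN m).prod (gaussN m)).map (fun z => (z.1, ρ • z.1 + c • z.2)) := by
  let T : (Fin n → ℝ) →L[ℝ] (Fin m → ℝ) × (Fin m → ℝ) :=
    (LinearMap.toContinuousLinearMap (Matrix.mulVecLin P)).prod
      (LinearMap.toContinuousLinearMap (Matrix.mulVecLin Q))
  let S : (Fin m → ℝ) × (Fin m → ℝ) →L[ℝ] (Fin m → ℝ) × (Fin m → ℝ) :=
    (ContinuousLinearMap.fst ℝ _ _).prod
      (ρ • ContinuousLinearMap.fst ℝ _ _ + c • ContinuousLinearMap.snd ℝ _ _)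
  change (gaussN n).map T = ((gaussN m).prod (gaussN m)).map S
  have : IsProbabilityMeasure ((gaussN n).map T) :=
    Measure.isProbabilityMeasure_map (by fun_prop)
  have : IsProbabilityMeasure (((gaussN m).prod (gaussN m)).map S) :=
    Measure.isProbabilityMeasure_map (by fun_prop)
  refine Measure.ext_of_charFunDual (funext fun L => ?_)
  rw [charFunDual_map, charFunDual_map, charFunDual_prod, charFunDual_gaussN, charFunDual_gaussN,
    charFunDual_gaussN, ← Complex.exp_add]
  congr 1
  rw [← add_div, ← neg_add, ← Complex.ofReal_add]
  congr 3
  set s : Fin m → ℝ := fun i => L.comp (.inl ℝ _ _) (Pi.single i 1) with hs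
  set t : Fin m → ℝ := fun i => L.comp (.inr ℝ _ _) (Pi.single i 1) with ht
  have h1 : ∀ j, (L.comp T) (Pi.single j 1) = (s ᵥ* P + t ᵥ* Q) j := by
    intro j
    have : (L.comp T) (Pi.single j 1) = L.comp (.inl ℝ _ _) (P *ᵥ Pi.single j 1)
        + L.comp (.inr ℝ _ _) (Q *ᵥ Pi.single j 1) := by
      simp [T, ← map_add]
    rw [this, apply_mulVec_eq, apply_mulVec_eq]
    rfl
  have h2 : ∀ i, ((L.comp S).comp (.inl ℝ _ _)) (Pi.single i 1) = s i + ρ * t i := by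
    intro i
    simp only [hs, ht, ← smul_eq_mul, ← map_smul, S]
    rw [ContinuousLinearMap.comp_apply, ContinuousLinearMap.comp_apply,
      ContinuousLinearMap.comp_apply, ContinuousLinearMap.comp_apply, ← map_add]
    congr 1
    simp
  have h3 : ∀ i, ((L.comp S).comp (.inr ℝ _ _)) (Pi.single i 1) = c * t i := by
    intro i
    simp only [ht, ← smul_eq_mul, ← map_smul, S]
    rw [ContinuousLinearMap.comp_apply, ContinuousLinearMap.comp_apply,
      ContinuousLinearMap.comp_apply]
    congr 1
    simp
  have hvec : ∀ (u v : Fin m → ℝ) (A B : Matrix (Fin m) (Fin n) ℝ),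
      (u ᵥ* A) ⬝ᵥ (v ᵥ* B) = u ⬝ᵥ ((A * Bᵀ) *ᵥ v) := by
    intro u v A B
    rw [← Matrix.mulVec_mulVec, Matrix.dotProduct_mulVec, Matrix.mulVec_transpose]
  have hQP : Q * Pᵀ = ρ • (1 : Matrix (Fin m) (Fin m) ℝ) := by
    have := congrArg Matrix.transpose hPQ
    simpa [Matrix.transpose_mul] using this
  have h4 : ∑ j, (L.comp T) (Pi.single j 1) ^ 2 = (s ᵥ* P + t ᵥ* Q) ⬝ᵥ (s ᵥ* P + t ᵥ* Q) := by
    simp_rw [h1, dotProduct, sq]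
  -- Both characteristic exponents are the quadratic form `|s|² + 2ρ s·t + |t|²`: on the left as
  -- `|sP + tQ|²`, on the right as `|s + ρt|² + c²|t|²`.
  rw [h4, add_dotProduct, dotProduct_add, dotProduct_add, hvec, hvec, hvec, hvec, hP, hQ, hPQ, hQP]
  simp_rw [h2, h3, Matrix.smul_mulVec, Matrix.one_mulVec, dotProduct, ← Finset.sum_add_distrib]
  refine Finset.sum_congr rfl fun i _ => ?_
  simp only [Pi.smul_apply, smul_eq_mul]
  linear_combination (-(t i) ^ 2) * hc

theorem measurePreserving_mulVec_gaussN {m n : ℕ} {P : Matrix (Fin m) (Fin n) ℝ}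
    (hP : P * Pᵀ = 1) : MeasurePreserving (fun x => P *ᵥ x) (gaussN n) (gaussN m) := by
  refine ⟨by fun_prop, ?_⟩
  -- The degenerate case `Q = P`, `ρ = 1`, `c = 0` of the joint law; only its first marginal
  -- matters.
  have h := congrArg (Measure.map Prod.fst)
    (map_mulVec_prod_gaussN (ρ := 1) (c := 0) hP hP (by simpa using hP) (by norm_num))
  rw [Measure.map_map (by fun_prop) (by fun_prop), Measure.map_map (by fun_prop) (by fun_prop)] at h
  change (gaussN n).map (fun x => P *ᵥ x) = ((gaussN m).prod (gaussN m)).map Prod.fst at h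
  rw [h, Measure.map_fst_prod]
  simp

/-! ### The degree filtration and Gaussian averaging of polynomials -/

/-- Real polynomials in `m` variables of total degree less than `k`. -/
noncomputable def polyDegLT (m k : ℕ) : Submodule ℝ (MvPolynomial (Fin m) ℝ) :=
  MvPolynomial.restrictSupport ℝ {s | s.degree < k}

theorem polyDegLT_mono (m : ℕ) : Monotone (polyDegLT m) := fun _ _ h =>
  MvPolynomial.restrictSupport_mono ℝ fun _ hs => lt_of_lt_of_le hs h

theorem mem_polyDegLT_totalDegree {m : ℕ} (q : MvPolynomial (Fin m) ℝ) :
    q ∈ polyDegLT m (q.totalDegree + 1) := by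
  intro s hs
  have := MvPolynomial.le_totalDegree hs
  rw [Finsupp.sum_fintype _ _ (by simp), ← Finsupp.degree_eq_sum] at this
  exact Nat.lt_succ_of_le this

theorem totalDegree_le_of_mem_polyDegLT {m k : ℕ} {q : MvPolynomial (Fin m) ℝ}
    (hq : q ∈ polyDegLT m (k + 1)) : q.totalDegree ≤ k := by
  refine Finset.sup_le fun s hs => ?_
  have h : s.degree < k + 1 := hq hs
  rw [Finsupp.sum_fintype _ _ (by simp), ← Finsupp.degree_eq_sum]
  exact Nat.le_of_lt_succ h

theorem polyDegLT_zero (m : ℕ) : polyDegLT m 0 = ⊥ := by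
  rw [eq_bot_iff]
  intro q hq
  have : q.support = ∅ := Finset.eq_empty_of_forall_notMem fun s hs => by
    have h : s.degree < 0 := hq hs
    simp at h
  simpa using this

instance finiteDimensional_polyDegLT (m k : ℕ) : FiniteDimensional ℝ (polyDegLT m k) := by
  rw [polyDegLT, MvPolynomial.restrictSupport_eq_span]
  refine FiniteDimensional.span_of_finite ℝ (Set.Finite.image _ ?_)
  have : {s : Fin m →₀ ℕ | s.degree < k} ⊆
      (DFunLike.coe : (Fin m →₀ ℕ) → Fin m → ℕ) ⁻¹' (Set.univ.pi fun _ => Set.Iio k) := by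
    intro s hs i _
    exact lt_of_le_of_lt (Finsupp.le_degree i s) hs
  exact ((Set.Finite.pi' fun _ => Set.finite_Iio k).preimage
    (DFunLike.coe_injective.injOn)).subset (by simpa [Set.pi] using this)

theorem mul_X_mem_polyDegLT {m k : ℕ} {q : MvPolynomial (Fin m) ℝ} (hq : q ∈ polyDegLT m k)
    (i : Fin m) : q * MvPolynomial.X i ∈ polyDegLT m (k + 1) := by
  rw [polyDegLT, MvPolynomial.restrictSupport_eq_span] at hq
  induction hq using Submodule.span_induction with
  | mem q hq =>
    obtain ⟨s, hs, rfl⟩ := hq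
    rw [MvPolynomial.X, MvPolynomial.monomial_mul, polyDegLT,
      MvPolynomial.monomial_mem_restrictSupport]
    left
    simpa using hs
  | zero => simp
  | add p q _ _ hp hq => rw [add_mul]; exact add_mem hp hq
  | smul a q _ hq => rw [smul_mul_assoc]; exact Submodule.smul_mem _ _ hq

theorem memLp_eval_gaussN {m : ℕ} (q : MvPolynomial (Fin m) ℝ) {p : ℝ≥0∞} (hp : p ≠ ∞) :
    MemLp (fun x => MvPolynomial.eval x q) p (gaussN m) := by
  induction q using MvPolynomial.induction_on generalizing p with
  | C a => simpa using memLp_const a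
  | add q r hq hr => simp only [map_add]; exact (hq hp).add (hr hp)
  | mul_X q i hq =>
    have hX : ∀ {p : ℝ≥0∞}, p ≠ ∞ → MemLp (fun x : Fin m → ℝ => x i) p (gaussN m) := by
      intro p hp
      exact (memLp_id_gaussianReal' p hp).comp_measurePreserving
        (measurePreserving_eval (fun _ : Fin m => gaussianReal 0 1) i)
    have : ENNReal.HolderTriple (2 * p) (2 * p) p := ⟨by
      rw [ENNReal.mul_inv (by simp) (by simp), ← add_mul, ENNReal.inv_two_add_inv_two, one_mul]⟩
    simpa [mul_comm] using (hX (ENNReal.mul_ne_top (by simp) hp)).mul'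
      (hq (ENNReal.mul_ne_top (by simp) hp)) (p := 2 * p) (q := 2 * p) (r := p)

theorem integrable_eval_gaussN {m : ℕ} (q : MvPolynomial (Fin m) ℝ) :
    Integrable (fun x => MvPolynomial.eval x q) (gaussN m) :=
  memLp_one_iff_integrable.mp (memLp_eval_gaussN q (by simp))

/-- Substituting `ρ x + c z` for the variables, as a polynomial in `z`. -/
theorem exists_eval_affine {m : ℕ} (ρ c : ℝ) (x : Fin m → ℝ) (q : MvPolynomial (Fin m) ℝ) :
    ∃ r : MvPolynomial (Fin m) ℝ, ∀ z,
      MvPolynomial.eval (ρ • x + c • z) q = MvPolynomial.eval z r := by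
  refine ⟨MvPolynomial.bind₁
    (fun i => MvPolynomial.C (ρ * x i) + MvPolynomial.C c * MvPolynomial.X i) q, fun z => ?_⟩
  rw [← MvPolynomial.coe_aeval_eq_eval, ← MvPolynomial.coe_aeval_eq_eval, RingHom.coe_coe,
    RingHom.coe_coe, MvPolynomial.aeval_bind₁]
  congr 2
  ext i
  simp

theorem integrable_eval_affine_mul {m : ℕ} (ρ c : ℝ) (x : Fin m → ℝ)
    (q u : MvPolynomial (Fin m) ℝ) :
    Integrable (fun z => MvPolynomial.eval (ρ • x + c • z) q * MvPolynomial.eval z u)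
      (gaussN m) := by
  obtain ⟨r, hr⟩ := exists_eval_affine ρ c x q
  simp_rw [hr, ← map_mul]
  exact integrable_eval_gaussN _

/-- The factor `u` makes the induction close: peeling off a variable produces `ρ xᵢ + c zᵢ`, the
first term feeds the leading coefficient and the factor `zᵢ` of the second is absorbed into `u`,
leaving a monomial of smaller degree. -/
theorem integral_eval_affine_monomial {m : ℕ} (ρ c : ℝ) (k : ℕ) :
    ∀ (s : Fin m →₀ ℕ) (a : ℝ), s.degree = k → ∀ u : MvPolynomial (Fin m) ℝ,
      ∃ r ∈ polyDegLT m k, ∀ x,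
        ∫ z, MvPolynomial.eval (ρ • x + c • z) (MvPolynomial.monomial s a) *
          MvPolynomial.eval z u ∂(gaussN m) =
        ρ ^ k * MvPolynomial.eval x (MvPolynomial.monomial s a) *
          ∫ z, MvPolynomial.eval z u ∂(gaussN m) + MvPolynomial.eval x r := by
  induction k with
  | zero =>
    intro s a hs u
    obtain rfl : s = 0 := (Finsupp.degree_eq_zero_iff s).mp hs
    refine ⟨0, zero_mem _, fun x => ?_⟩
    simp [integral_const_mul]
  | succ k ih =>
    intro s a hs u
    obtain ⟨i, hi⟩ : ∃ i, s i ≠ 0 := by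
      by_contra! h
      obtain rfl : s = 0 := Finsupp.ext h
      simp at hs
    obtain ⟨t, rfl⟩ : ∃ t, s = t + Finsupp.single i 1 :=
      ⟨s - Finsupp.single i 1, (tsub_add_cancel_of_le (by
        rw [Finsupp.single_le_iff]; omega)).symm⟩
    have ht : t.degree = k := by simpa using hs
    have hmon : MvPolynomial.monomial (t + Finsupp.single i 1) a
        = MvPolynomial.monomial t a * MvPolynomial.X i := by
      rw [MvPolynomial.X, MvPolynomial.monomial_mul, mul_one]
    obtain ⟨r, hr, hr'⟩ := ih t a ht u
    obtain ⟨r₂, hr₂, hr₂'⟩ := ih t a ht (MvPolynomial.X i * u)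
    set q := MvPolynomial.monomial t a with hq
    have hqm : q ∈ polyDegLT m (k + 1) := by
      rw [hq, polyDegLT, MvPolynomial.monomial_mem_restrictSupport]
      left
      simp [ht]
    refine ⟨ρ • (r * MvPolynomial.X i) + c • ((ρ ^ k *
      ∫ z, MvPolynomial.eval z (MvPolynomial.X i * u) ∂(gaussN m)) • q + r₂), ?_, fun x => ?_⟩
    · exact add_mem (Submodule.smul_mem _ _ (mul_X_mem_polyDegLT hr i))
        (Submodule.smul_mem _ _ (add_mem (Submodule.smul_mem _ _ hqm)
          (polyDegLT_mono m (Nat.le_succ k) hr₂)))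
    · have h1 : ∀ z, MvPolynomial.eval (ρ • x + c • z) (q * MvPolynomial.X i) *
          MvPolynomial.eval z u = ρ * x i * (MvPolynomial.eval (ρ • x + c • z) q *
          MvPolynomial.eval z u) + c * (MvPolynomial.eval (ρ • x + c • z) q *
          MvPolynomial.eval z (MvPolynomial.X i * u)) := by
        intro z
        simp
        ring
      rw [hmon]
      simp_rw [h1]
      rw [integral_add ((integrable_eval_affine_mul ρ c x q u).const_mul _)
        ((integrable_eval_affine_mul ρ c x q _).const_mul _), integral_const_mul,
        integral_const_mul, hr', hr₂']
      simp only [map_mul, map_add, MvPolynomial.smul_eval, MvPolynomial.eval_X]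
      ring

/-- Noise averaging is triangular for the degree filtration, with `ρ^k` on the `k`-th diagonal
block. This is all that is used about its spectrum. -/
theorem integral_eval_affine {m : ℕ} (ρ c : ℝ) (k : ℕ) {q : MvPolynomial (Fin m) ℝ}
    (hq : q ∈ polyDegLT m (k + 1)) :
    ∃ r ∈ polyDegLT m k, ∀ x,
      ∫ z, MvPolynomial.eval (ρ • x + c • z) q ∂(gaussN m) =
        ρ ^ k * MvPolynomial.eval x q + MvPolynomial.eval x r := by
  have hint : ∀ q x, Integrable (fun z => MvPolynomial.eval (ρ • x + c • z) q) (gaussN m) := by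
    intro q x
    simpa using integrable_eval_affine_mul ρ c x q 1
  rw [polyDegLT, MvPolynomial.restrictSupport_eq_span] at hq
  induction hq using Submodule.span_induction with
  | mem q hq =>
    obtain ⟨s, hs, rfl⟩ := hq
    obtain ⟨r, hr, hr'⟩ := integral_eval_affine_monomial ρ c s.degree s 1 rfl 1
    simp only [map_one, mul_one, integral_const, probReal_univ, smul_eq_mul] at hr'
    rcases (Nat.lt_succ_iff.mp hs).eq_or_lt with h | h
    · subst h
      exact ⟨r, hr, hr'⟩
    -- A monomial of degree below `k` comes with its own power of `ρ`; the discrepancy is of lower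
    -- degree and goes into the remainder.
    · refine ⟨r + (ρ ^ s.degree - ρ ^ k) • MvPolynomial.monomial s 1,
        add_mem (polyDegLT_mono m h.le hr) (Submodule.smul_mem _ _ ?_), fun x => ?_⟩
      · rw [polyDegLT, MvPolynomial.monomial_mem_restrictSupport]
        exact Or.inl h
      · rw [hr', map_add, MvPolynomial.smul_eval]
        ring
  | zero => exact ⟨0, zero_mem _, by simp⟩
  | add p q _ _ hp hq =>
    obtain ⟨r, hr, hr'⟩ := hp
    obtain ⟨s, hs, hs'⟩ := hq
    refine ⟨r + s, add_mem hr hs, fun x => ?_⟩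
    simp_rw [map_add]
    rw [integral_add (hint _ _) (hint _ _), hr', hs']
    ring
  | smul a q _ hq =>
    obtain ⟨r, hr, hr'⟩ := hq
    refine ⟨a • r, Submodule.smul_mem _ _ hr, fun x => ?_⟩
    simp_rw [MvPolynomial.smul_eval]
    rw [integral_const_mul, hr']
    ring

/-! ### Symmetric operators that are triangular on a filtration -/

open scoped RealInnerProductSpace in
/-- A symmetric operator which acts on a filtration by finite-dimensional subspaces as `ρ ^ k` on the
`k`-th graded piece has quadratic form at most `ρ ^ d` on the complement of the `d`-th subspace. -/
theorem abs_inner_le_pow_of_filtration {E : Type*} [NormedAddCommGroup E] [InnerProductSpace ℝ E]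
    {V : ℕ → Submodule ℝ E} (hV : Monotone V) [∀ k, (V k).HasOrthogonalProjection]
    (hdense : Dense (⋃ k, (V k : Set E))) {T : E →L[ℝ] E} (hsymm : ∀ x y, ⟪T x, y⟫ = ⟪x, T y⟫)
    {ρ : ℝ} (hρ : 0 ≤ ρ) (hρ' : ρ ≤ 1) (hT : ∀ k, ∀ v ∈ V (k + 1), T v - ρ ^ k • v ∈ V k)
    (hzero : V 0 = ⊥) (d : ℕ) {g : E} (hg : g ∈ (V d)ᗮ) :
    |⟪g, T g⟫| ≤ ρ ^ d * ‖g‖ ^ 2 := by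
  have hinv : ∀ k, ∀ v ∈ V k, T v ∈ V k := by
    intro k v hv
    cases k with
    | zero =>
      rw [hzero, Submodule.mem_bot] at hv ⊢
      simp [hv]
    | succ k =>
      have := add_mem (hV (Nat.le_succ k) (hT k v hv)) ((V (k + 1)).smul_mem (ρ ^ k) hv)
      simpa using this
  have hfin : ∀ k, d ≤ k → ∀ p ∈ V k, p ∈ (V d)ᗮ → |⟪p, T p⟫| ≤ ρ ^ d * ‖p‖ ^ 2 := by
    intro k hk
    induction k, hk using Nat.le_induction with
    | base =>
      intro p hp hp'
      have : p = 0 := by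
        rw [← inner_self_eq_zero (𝕜 := ℝ)]
        exact (Submodule.mem_orthogonal _ _).mp hp' p hp
      simp [this]
    | succ k hk ih =>
      intro p hp hp'
      obtain ⟨p', hp'k, w, hw, rfl⟩ := (V k).exists_add_mem_mem_orthogonal p
      have hwk : w ∈ V (k + 1) := by
        simpa using sub_mem hp (hV (Nat.le_succ k) hp'k)
      have hworth : ∀ h ∈ V k, ⟪w, h⟫ = 0 := fun h hh => by
        rw [real_inner_comm]; exact (Submodule.mem_orthogonal _ _).mp hw h hh
      -- The defect `T w - ρ^k w` lies in `V k`. It is also orthogonal to `V k`, because `w` is and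
      -- the symmetric `T` preserves `V k`.
      have hTw : T w = ρ ^ k • w := by
        rw [← sub_eq_zero, ← inner_self_eq_zero (𝕜 := ℝ)]
        have h := hT k w hwk
        nth_rw 1 [inner_sub_left]
        rw [hsymm, real_inner_smul_left, hworth _ (hinv k _ h), hworth _ h]
        simp
      have hp'd : p' ∈ (V d)ᗮ := by
        rw [Submodule.mem_orthogonal] at hp' ⊢
        intro u hu
        have := hp' u hu
        rw [inner_add_right, (Submodule.mem_orthogonal _ _).mp hw u (hV hk hu), add_zero] at this
        exact this
      have h1 : ⟪p' + w, T (p' + w)⟫ = ⟪p', T p'⟫ + ρ ^ k * ‖w‖ ^ 2 := by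
        rw [map_add, hTw, inner_add_left, inner_add_right, inner_add_right,
          hworth _ (hinv k _ hp'k), real_inner_smul_right, real_inner_smul_right,
          real_inner_comm w p', hworth _ hp'k, real_inner_self_eq_norm_sq]
        ring
      have h2 : ‖p' + w‖ ^ 2 = ‖p'‖ ^ 2 + ‖w‖ ^ 2 := by
        rw [← real_inner_self_eq_norm_sq, inner_add_left, inner_add_right, inner_add_right,
          real_inner_comm w p', hworth _ hp'k, real_inner_self_eq_norm_sq,
          real_inner_self_eq_norm_sq]
        ring
      have h3 : |ρ ^ k * ‖w‖ ^ 2| ≤ ρ ^ d * ‖w‖ ^ 2 := by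
        rw [abs_of_nonneg (by positivity)]
        exact mul_le_mul_of_nonneg_right (pow_le_pow_of_le_one hρ hρ' hk) (by positivity)
      rw [h1, h2, mul_add]
      exact (abs_add_le _ _).trans (add_le_add (ih p' hp'k hp'd) h3)
  -- Density is applied to all of `E` after projecting: `R` maps each `V k` with `k ≥ d` into
  -- itself, so the bound for `R x` is a closed condition that holds on a dense set.
  let R : E →L[ℝ] E := ContinuousLinearMap.id ℝ E - (V d).starProjection
  have hR : ∀ x, R x ∈ (V d)ᗮ := fun x => (V d).sub_starProjection_mem_orthogonal x
  have hclosed : IsClosed {x | |⟪R x, T (R x)⟫| ≤ ρ ^ d * ‖R x‖ ^ 2} :=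
    isClosed_le (by fun_prop) (by fun_prop)
  have hall : ∀ x, |⟪R x, T (R x)⟫| ≤ ρ ^ d * ‖R x‖ ^ 2 := by
    have hsub : (⋃ k, (V k : Set E)) ⊆ {x | |⟪R x, T (R x)⟫| ≤ ρ ^ d * ‖R x‖ ^ 2} := by
      intro x hx
      obtain ⟨k, hk⟩ := Set.mem_iUnion.mp hx
      refine hfin (max k d) (le_max_right _ _) _ (sub_mem (hV (le_max_left _ _) hk)
        (hV (le_max_right _ _) ?_)) (hR x)
      exact (V d).starProjection_apply_mem x
    intro x
    exact hclosed.closure_subset_iff.mpr hsub (hdense x)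
  have hRg : R g = g := by
    simp [R, (V d).starProjection_apply_eq_zero_iff.mpr hg]
  simpa [hRg] using hall g

/-! ### Density of polynomials in Gaussian `L²` -/

/-- A square integrable function orthogonal to all polynomials under the Gaussian vanishes. -/
theorem ae_eq_zero_of_integral_mul_eval_eq_zero {m : ℕ} {g : (Fin m → ℝ) → ℝ}
    (hgm : Measurable g) (hg : MemLp g 2 (gaussN m))
    (h : ∀ q : MvPolynomial (Fin m) ℝ, ∫ x, g x * MvPolynomial.eval x q ∂(gaussN m) = 0) :
    g =ᵐ[gaussN m] 0 := by
  have hgi : Integrable g (gaussN m) := hg.integrable (by norm_num)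
  have hexp : ∀ L : StrongDual ℝ (Fin m → ℝ), MemLp (fun x => Real.exp |L x|) 2 (gaussN m) := by
    intro L
    have hm : Measurable fun x => Real.exp |L x| :=
      Real.measurable_exp.comp (by fun_prop : Measurable fun x => |L x|)
    rw [memLp_two_iff_integrable_sq hm.aestronglyMeasurable]
    have key : ∀ t : ℝ, Integrable (fun x => Real.exp (t * L x)) (gaussN m) := by
      intro t
      have := integrable_exp_mul_gaussianReal (μ := 0)
        (v := (∑ i, L (Pi.single i 1) ^ 2).toNNReal) t
      rw [← map_dual_gaussN] at this
      exact this.comp_measurable (by fun_prop)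
    have := integrable_exp_mul_abs (key 2) (key (-2))
    refine this.congr (ae_of_all _ fun x => ?_)
    simp only [two_mul, Real.exp_add, sq]
  have hpow : ∀ (L : StrongDual ℝ (Fin m → ℝ)) (k : ℕ), ∃ q : MvPolynomial (Fin m) ℝ,
      ∀ x, L x ^ k = MvPolynomial.eval x q := by
    intro L k
    refine ⟨(∑ i, MvPolynomial.C (L (Pi.single i 1)) * MvPolynomial.X i) ^ k, fun x => ?_⟩
    rw [map_pow, map_sum]
    congr 1
    conv_lhs => rw [← Finset.univ_sum_single x, map_sum]
    refine Finset.sum_congr rfl fun i _ => ?_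
    have : (Pi.single i (x i) : Fin m → ℝ) = x i • Pi.single i 1 := by
      rw [← Pi.single_smul]; simp
    rw [this, map_smul]
    simp [mul_comm]
  have hchar : ∀ L : StrongDual ℝ (Fin m → ℝ),
      ∫ x, (g x : ℂ) * Complex.exp (L x * Complex.I) ∂(gaussN m) = 0 := by
    intro L
    -- The exponential series is integrated against `g` term by term, and each term is a polynomial
    -- moment. The dominating function `|g| exp |L|` is integrable as a product of two `L²`
    -- functions.
    have hlim := tendsto_integral_of_dominated_convergence (μ := gaussN m)
      (F := fun N x => (g x : ℂ) * ∑ k ∈ Finset.range N, (L x * Complex.I) ^ k / (k.factorial : ℂ))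
      (f := fun x => (g x : ℂ) * Complex.exp (L x * Complex.I))
      (fun x => |g x| * Real.exp |L x|) (fun N => ?_) ?_ (fun N => ae_of_all _ fun x => ?_)
      (ae_of_all _ fun x => ?_)
    · refine tendsto_nhds_unique hlim (tendsto_const_nhds.congr fun N => ?_)
      simp_rw [Finset.mul_sum]
      have hterm : ∀ k x, (g x : ℂ) * ((L x * Complex.I) ^ k / (k.factorial : ℂ)) =
          ((g x * L x ^ k : ℝ) : ℂ) * (Complex.I ^ k / (k.factorial : ℂ)) := by
        intro k x; push_cast; ring
      simp_rw [hterm]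
      rw [integral_finsetSum]
      · symm
        refine Finset.sum_eq_zero fun k _ => ?_
        obtain ⟨q, hq⟩ := hpow L k
        rw [integral_mul_const, integral_complex_ofReal]
        simp_rw [hq]
        rw [h]
        simp
      · intro k _
        obtain ⟨q, hq⟩ := hpow L k
        refine Integrable.mul_const (Integrable.ofReal ?_) _
        simp_rw [hq]
        exact hg.integrable_mul (memLp_eval_gaussN q (p := 2) (by simp))
    · exact (by fun_prop : Measurable _).aestronglyMeasurable
    · exact hg.abs.integrable_mul (hexp L)
    · rw [norm_mul, Complex.norm_real, Real.norm_eq_abs]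
      refine mul_le_mul_of_nonneg_left ?_ (abs_nonneg _)
      refine (norm_sum_le _ _).trans ?_
      have : ∀ k, ‖(L x * Complex.I) ^ k / (k.factorial : ℂ)‖ = |L x| ^ k / k.factorial := by
        intro k; simp
      simp_rw [this]
      exact Real.sum_le_exp_of_nonneg (abs_nonneg _) N
    · refine Filter.Tendsto.const_mul _ ?_
      have := (NormedSpace.expSeries_div_hasSum_exp (𝔸 := ℂ) (L x * Complex.I)).tendsto_sum_nat
      rwa [← Complex.exp_eq_exp_ℂ] at this
  have hfin : ∀ f : (Fin m → ℝ) → ℝ, Integrable f (gaussN m) →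
      IsFiniteMeasure ((gaussN m).withDensity fun x => ENNReal.ofReal (f x)) :=
    fun f hf => isFiniteMeasure_withDensity_ofReal hf.2
  have := hfin g hgi
  have := hfin (fun x => -g x) hgi.neg
  -- Vanishing of the Fourier transform of `g` says that the measures with densities `g⁺` and `g⁻`
  -- have the same characteristic function.
  have heq : (gaussN m).withDensity (fun x => ENNReal.ofReal (g x)) =
      (gaussN m).withDensity (fun x => ENNReal.ofReal (-g x)) := by
    refine Measure.ext_of_charFunDual (funext fun L => ?_)
    have hE : ∀ f : (Fin m → ℝ) → ℝ, Integrable f (gaussN m) →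
        Integrable (fun x => (f x : ℂ) * Complex.exp (L x * Complex.I)) (gaussN m) := by
      intro f hf
      refine hf.ofReal.mul_bdd (c := 1) (by fun_prop) (ae_of_all _ fun x => ?_)
      rw [Complex.norm_exp_ofReal_mul_I]
    rw [charFunDual_apply, charFunDual_apply,
      integral_withDensity_eq_integral_toReal_smul (by fun_prop) (by simp),
      integral_withDensity_eq_integral_toReal_smul (by fun_prop) (by simp), ← sub_eq_zero]
    simp only [ENNReal.toReal_ofReal', Complex.real_smul]
    rw [← integral_sub (hE _ hgi.pos_part) (hE _ hgi.neg_part), ← hchar L]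
    congr 1
    ext x
    rw [← sub_mul, ← Complex.ofReal_sub, max_zero_sub_max_neg_zero_eq_self]
  rw [withDensity_eq_iff (by fun_prop) (by fun_prop) (by
    have := hgi.2
    exact (lt_of_le_of_lt (lintegral_mono fun x => by
      exact Real.ofReal_le_enorm (g x)) this).ne)] at heq
  filter_upwards [heq] with x hx
  rcases le_total 0 (g x) with h0 | h0
  · rw [ENNReal.ofReal_of_nonpos (neg_nonpos.mpr h0), ENNReal.ofReal_eq_zero] at hx
    exact le_antisymm hx h0
  · rw [ENNReal.ofReal_of_nonpos h0, eq_comm, ENNReal.ofReal_eq_zero] at hx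
    exact le_antisymm h0 (neg_nonpos.mp hx)

theorem inner_toLp_eq_integral {α : Type*} [MeasurableSpace α] {μ : Measure α} {f g : α → ℝ}
    (hf : MemLp f 2 μ) (hg : MemLp g 2 μ) :
    inner ℝ (hf.toLp f) (hg.toLp g) = ∫ x, f x * g x ∂μ := by
  rw [L2.inner_def]
  refine integral_congr_ae ?_
  filter_upwards [hf.coeFn_toLp, hg.coeFn_toLp] with x hx hy
  rw [hx, hy]
  simp [mul_comm]

theorem norm_toLp_sq_eq_integral {α : Type*} [MeasurableSpace α] {μ : Measure α} {f : α → ℝ}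
    (hf : MemLp f 2 μ) : ‖hf.toLp f‖ ^ 2 = ∫ x, f x ^ 2 ∂μ := by
  rw [← real_inner_self_eq_norm_sq, inner_toLp_eq_integral]
  simp_rw [sq]

theorem memLp_two_eval_gaussN {m : ℕ} (q : MvPolynomial (Fin m) ℝ) :
    MemLp (fun x => MvPolynomial.eval x q) 2 (gaussN m) :=
  memLp_eval_gaussN q (by simp)

/-- Polynomials as elements of `L²` of the Gaussian. -/
noncomputable def polyToLp (m : ℕ) : MvPolynomial (Fin m) ℝ →ₗ[ℝ] Lp ℝ 2 (gaussN m) where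
  toFun q := (memLp_two_eval_gaussN q).toLp _
  map_add' p q := by
    rw [← MemLp.toLp_add]
    congr 1
    ext x
    simp
  map_smul' a q := by
    rw [RingHom.id_apply, ← MemLp.toLp_const_smul]
    congr 1
    ext x
    simp [MvPolynomial.smul_eval]

theorem polyToLp_apply {m : ℕ} (q : MvPolynomial (Fin m) ℝ) :
    polyToLp m q = (memLp_two_eval_gaussN q).toLp _ := rfl

theorem dense_iUnion_map_polyToLp (m : ℕ) :
    Dense (⋃ k, ((polyDegLT m k).map (polyToLp m) : Set (Lp ℝ 2 (gaussN m)))) := by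
  have hsub : ((LinearMap.range (polyToLp m) : Submodule ℝ _) : Set (Lp ℝ 2 (gaussN m))) ⊆
      ⋃ k, ((polyDegLT m k).map (polyToLp m) : Set (Lp ℝ 2 (gaussN m))) := by
    rintro _ ⟨q, rfl⟩
    exact Set.mem_iUnion.mpr ⟨_, q, mem_polyDegLT_totalDegree q, rfl⟩
  refine Dense.mono hsub ?_
  rw [Submodule.dense_iff_topologicalClosure_eq_top, Submodule.topologicalClosure_eq_top_iff,
    Submodule.eq_bot_iff]
  intro g hg
  obtain ⟨g', hg'm, hg'⟩ := (Lp.aestronglyMeasurable g)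
  have hmem : MemLp g' 2 (gaussN m) := (memLp_congr_ae hg').mp (Lp.memLp g)
  have hgeq : g = hmem.toLp g' := by
    rw [← Lp.toLp_coeFn g (Lp.memLp g)]
    exact MemLp.toLp_congr _ _ hg'
  have := ae_eq_zero_of_integral_mul_eval_eq_zero hg'm.measurable hmem (fun q => by
    have h := (Submodule.mem_orthogonal' _ _).mp hg (polyToLp m q) ⟨q, rfl⟩
    rwa [hgeq, polyToLp_apply, inner_toLp_eq_integral] at h)
  rw [hgeq]
  exact (MemLp.toLp_congr hmem MemLp.zero this).trans (MemLp.toLp_zero _)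

/-! ### Decay of correlation between projections -/

/-- Transfer to the law of `(X, ρX + cZ)`, then Fubini. The right side sees `P` and `Q` only through
`ρ` and `c`, so exchanging them changes nothing; the symmetry of the correlation operator comes from
this. -/
theorem integral_mul_eval_mulVec {m n : ℕ} {P Q : Matrix (Fin m) (Fin n) ℝ} {ρ c : ℝ}
    (hP : P * Pᵀ = 1) (hQ : Q * Qᵀ = 1) (hPQ : P * Qᵀ = ρ • (1 : Matrix (Fin m) (Fin m) ℝ))
    (hc : ρ ^ 2 + c ^ 2 = 1) {h : (Fin m → ℝ) → ℝ} (hm : Measurable h)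
    (hh : MemLp h 2 (gaussN m)) (q : MvPolynomial (Fin m) ℝ) :
    ∫ x, h (P *ᵥ x) * MvPolynomial.eval (Q *ᵥ x) q ∂(gaussN n) =
      ∫ x, h x * ∫ z, MvPolynomial.eval (ρ • x + c • z) q ∂(gaussN m) ∂(gaussN m) := by
  have hqm : Measurable fun x : Fin m → ℝ => MvPolynomial.eval x q :=
    (MvPolynomial.continuous_eval q).measurable
  let F : (Fin m → ℝ) × (Fin m → ℝ) → ℝ := fun w => h w.1 * MvPolynomial.eval w.2 q
  have hF : Measurable F := (hm.comp measurable_fst).mul (hqm.comp measurable_snd)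
  have hPQm : Measurable fun x : Fin n → ℝ => (P *ᵥ x, Q *ᵥ x) := by fun_prop
  have hSm : Measurable fun z : (Fin m → ℝ) × (Fin m → ℝ) => (z.1, ρ • z.1 + c • z.2) := by
    fun_prop
  have hlaw := map_mulVec_prod_gaussN hP hQ hPQ hc
  have hint : Integrable (fun z : (Fin m → ℝ) × (Fin m → ℝ) =>
      h z.1 * MvPolynomial.eval (ρ • z.1 + c • z.2) q) ((gaussN m).prod (gaussN m)) := by
    have h1 : Integrable (fun x => F (P *ᵥ x, Q *ᵥ x)) (gaussN n) :=
      (hh.comp_measurePreserving (measurePreserving_mulVec_gaussN hP)).integrable_mul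
        ((memLp_eval_gaussN q (p := 2) (by simp)).comp_measurePreserving
          (measurePreserving_mulVec_gaussN hQ))
    have h2 := (integrable_map_measure hF.aestronglyMeasurable hPQm.aemeasurable).mpr h1
    rw [hlaw] at h2
    exact (integrable_map_measure hF.aestronglyMeasurable hSm.aemeasurable).mp h2
  calc ∫ x, h (P *ᵥ x) * MvPolynomial.eval (Q *ᵥ x) q ∂(gaussN n)
      = ∫ w, F w ∂((gaussN n).map fun x => (P *ᵥ x, Q *ᵥ x)) :=
        (integral_map hPQm.aemeasurable hF.aestronglyMeasurable).symm
    _ = ∫ z, F (z.1, ρ • z.1 + c • z.2) ∂((gaussN m).prod (gaussN m)) := by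
        rw [hlaw, integral_map hSm.aemeasurable hF.aestronglyMeasurable]
    _ = _ := by
        rw [integral_prod _ hint]
        exact integral_congr_ae (ae_of_all _ fun x => integral_const_mul (h x) _)

/-- **Correlation decay.** If `g` is orthogonal to the polynomials of degree less than `d`, then two
projections with `P Qᵀ = ρ I` have correlation at most `ρ ^ d`. -/
theorem abs_integral_mul_mulVec_le {m n : ℕ} {P Q : Matrix (Fin m) (Fin n) ℝ} {ρ : ℝ}
    (hP : P * Pᵀ = 1) (hQ : Q * Qᵀ = 1) (hPQ : P * Qᵀ = ρ • (1 : Matrix (Fin m) (Fin m) ℝ))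
    (hρ : 0 ≤ ρ) (hρ' : ρ ≤ 1) {g : (Fin m → ℝ) → ℝ}
    (hg : MemLp g 2 (gaussN m)) {d : ℕ}
    (hd : ∀ q ∈ polyDegLT m d, ∫ x, g x * MvPolynomial.eval x q ∂(gaussN m) = 0) :
    |∫ x, g (P *ᵥ x) * g (Q *ᵥ x) ∂(gaussN n)| ≤ ρ ^ d * ∫ x, g x ^ 2 ∂(gaussN m) := by
  have hQP : Q * Pᵀ = ρ • (1 : Matrix (Fin m) (Fin m) ℝ) := by
    have := congrArg Matrix.transpose hPQ
    simpa [Matrix.transpose_mul] using this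
  have hc : ρ ^ 2 + √(1 - ρ ^ 2) ^ 2 = 1 := by
    rw [Real.sq_sqrt (by nlinarith)]; ring
  set c := √(1 - ρ ^ 2)
  let U := Lp.compMeasurePreservingₗᵢ (p := 2) (E := ℝ) ℝ _ (measurePreserving_mulVec_gaussN hP)
  let W := Lp.compMeasurePreservingₗᵢ (p := 2) (E := ℝ) ℝ _ (measurePreserving_mulVec_gaussN hQ)
  have hU : ∀ {h : (Fin m → ℝ) → ℝ} (hh : MemLp h 2 (gaussN m)), U (hh.toLp h) =
      (hh.comp_measurePreserving (measurePreserving_mulVec_gaussN hP)).toLp _ := fun hh =>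
    Lp.toLp_compMeasurePreserving hh _
  have hW : ∀ {h : (Fin m → ℝ) → ℝ} (hh : MemLp h 2 (gaussN m)), W (hh.toLp h) =
      (hh.comp_measurePreserving (measurePreserving_mulVec_gaussN hQ)).toLp _ := fun hh =>
    Lp.toLp_compMeasurePreserving hh _
  -- With `U` and `W` the pullbacks along `P` and `Q`, this is the operator whose bilinear form is
  -- `E[x(P·) y(Q·)]`.
  let T := (ContinuousLinearMap.adjoint U.toContinuousLinearMap).comp W.toContinuousLinearMap
  have hT : ∀ x y, inner ℝ x (T y) = inner ℝ (U x) (W y) := fun x y => by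
    simp only [T, ContinuousLinearMap.comp_apply, ContinuousLinearMap.adjoint_inner_right]
    rfl
  have hrep : ∀ x : Lp ℝ 2 (gaussN m), ∃ (h : (Fin m → ℝ) → ℝ) (hh : MemLp h 2 (gaussN m)),
      Measurable h ∧ x = hh.toLp h := by
    intro x
    obtain ⟨h, hm, hx⟩ := Lp.aestronglyMeasurable x
    have hmem : MemLp h 2 (gaussN m) := (memLp_congr_ae hx).mp (Lp.memLp x)
    refine ⟨h, hmem, hm.measurable, ?_⟩
    rw [← Lp.toLp_coeFn x (Lp.memLp x)]
    exact MemLp.toLp_congr _ _ hx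
  have hpoly : ∀ k, ∀ q ∈ polyDegLT m (k + 1), ∃ r ∈ polyDegLT m k,
      T (polyToLp m q) = ρ ^ k • polyToLp m q + polyToLp m r ∧
      ∀ x, inner ℝ (W x) (U (polyToLp m q)) = inner ℝ x (T (polyToLp m q)) := by
    intro k q hq
    obtain ⟨r, hr, hr'⟩ := integral_eval_affine ρ c k hq
    have key : ∀ {h : (Fin m → ℝ) → ℝ} (hh : MemLp h 2 (gaussN m)),
        inner ℝ (hh.toLp h) (ρ ^ k • polyToLp m q + polyToLp m r) =
        ∫ x, h x * ∫ z, MvPolynomial.eval (ρ • x + c • z) q ∂(gaussN m) ∂(gaussN m) := by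
      intro h hh
      rw [← map_smul, ← map_add, polyToLp_apply, inner_toLp_eq_integral]
      simp_rw [hr']
      simp [MvPolynomial.smul_eval]
    have hTq : T (polyToLp m q) = ρ ^ k • polyToLp m q + polyToLp m r := by
      refine ext_inner_left ℝ fun x => ?_
      obtain ⟨h, hh, hm, rfl⟩ := hrep x
      rw [hT, key hh, hU hh, ← integral_mul_eval_mulVec hP hQ hPQ hc hm hh q]
      rw [polyToLp_apply, hW, inner_toLp_eq_integral]
      rfl
    refine ⟨r, hr, hTq, fun x => ?_⟩
    obtain ⟨h, hh, hm, rfl⟩ := hrep x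
    rw [hTq, key hh, hW hh, ← integral_mul_eval_mulVec hQ hP hQP hc hm hh q]
    rw [polyToLp_apply, hU, inner_toLp_eq_integral]
    rfl
  have hdense := dense_iUnion_map_polyToLp m
  have hsymm : ∀ x y, inner ℝ (T x) y = inner ℝ x (T y) := by
    intro x y
    have hcl : IsClosed {y | inner ℝ (T x) y = inner ℝ x (T y)} :=
      isClosed_eq (by fun_prop) (by fun_prop)
    refine hcl.closure_subset_iff.mpr ?_ (hdense y)
    intro y hy
    obtain ⟨k, q, hq, rfl⟩ := Set.mem_iUnion.mp hy
    obtain ⟨r, -, -, hr⟩ := hpoly k q (polyDegLT_mono m (Nat.le_succ k) hq)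
    change inner ℝ (T x) (polyToLp m q) = inner ℝ x (T (polyToLp m q))
    rw [← hr x, real_inner_comm, hT, real_inner_comm]
  have hgorth : hg.toLp g ∈ ((polyDegLT m d).map (polyToLp m))ᗮ := by
    rw [Submodule.mem_orthogonal']
    rintro _ ⟨q, hq, rfl⟩
    rw [polyToLp_apply, inner_toLp_eq_integral, hd q hq]
  have := abs_inner_le_pow_of_filtration (V := fun k => (polyDegLT m k).map (polyToLp m))
    (fun _ _ hkl => Submodule.map_mono (polyDegLT_mono m hkl)) hdense hsymm hρ hρ' ?_
    (by rw [polyDegLT_zero, Submodule.map_bot]) d hgorth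
  · rw [hT, hU hg, hW hg, norm_toLp_sq_eq_integral, inner_toLp_eq_integral] at this
    exact this
  · rintro k _ ⟨q, hq, rfl⟩
    obtain ⟨r, hr, hTq, -⟩ := hpoly k q hq
    exact ⟨r, hr, by rw [hTq]; abel⟩

/-! ### Duality for `L¹`-approximation -/

/-- The inclusion of `L²` into `L¹` of a probability measure. -/
noncomputable def lpTwoToLpOne {α : Type*} [MeasurableSpace α] (μ : Measure α)
    [IsProbabilityMeasure μ] : Lp ℝ 2 μ →ₗ[ℝ] Lp ℝ 1 μ where
  toFun h := ((Lp.memLp h).mono_exponent (p := 1) (by norm_num)).toLp h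
  map_add' h k := by
    rw [← MemLp.toLp_add]
    exact MemLp.toLp_congr _ _ (Lp.coeFn_add h k)
  map_smul' a h := by
    rw [RingHom.id_apply, ← MemLp.toLp_const_smul]
    exact MemLp.toLp_congr _ _ (Lp.coeFn_smul a h)

theorem norm_lpTwoToLpOne {α : Type*} [MeasurableSpace α] {μ : Measure α}
    [IsProbabilityMeasure μ] (h : Lp ℝ 2 μ) :
    ‖lpTwoToLpOne μ h‖ = (eLpNorm h 1 μ).toReal :=
  Lp.norm_toLp _ ((Lp.memLp h).mono_exponent (p := 1) (by norm_num))

theorem norm_lpTwoToLpOne_le {α : Type*} [MeasurableSpace α] {μ : Measure α}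
    [IsProbabilityMeasure μ] (h : Lp ℝ 2 μ) : ‖lpTwoToLpOne μ h‖ ≤ ‖h‖ := by
  rw [norm_lpTwoToLpOne, Lp.norm_def]
  exact ENNReal.toReal_mono (Lp.eLpNorm_ne_top h)
    (eLpNorm_le_eLpNorm_of_exponent_le (by norm_num) (Lp.aestronglyMeasurable h))

/-- **Duality.** If `f` is at `L¹`-distance at least `ε` from a subspace `V`, then some function
bounded by one annihilates `V` and has correlation at least `ε` with `f`. -/
theorem exists_bounded_annihilator {α : Type*} [MeasurableSpace α] {μ : Measure α}
    [IsProbabilityMeasure μ] {f : α → ℝ} (hf : MemLp f 2 μ) {ε : ℝ} (V : Submodule ℝ (Lp ℝ 2 μ))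
    (hV : ∀ v ∈ V, ε ≤ (eLpNorm (f - (v : α → ℝ)) 1 μ).toReal) :
    ∃ g : α → ℝ, Measurable g ∧ (∀ x, |g x| ≤ 1) ∧ (∀ v ∈ V, ∫ x, g x * v x ∂μ = 0) ∧
      ε ≤ ∫ x, f x * g x ∂μ := by
  let W : Submodule ℝ (Lp ℝ 1 μ) := V.map (lpTwoToLpOne μ)
  obtain ⟨φ, hφ, hφf⟩ := exists_dual_vector'' ℝ (W.mkQ (lpTwoToLpOne μ (hf.toLp f)))
  rw [RCLike.ofReal_real_eq_id, id_eq] at hφf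
  have hφ1 : ∀ h, |φ (W.mkQ (lpTwoToLpOne μ h))| ≤ ‖lpTwoToLpOne μ h‖ := by
    intro h
    refine (φ.le_of_opNorm_le hφ _).trans ?_
    rw [one_mul]
    exact Submodule.Quotient.norm_mk_le W _
  let ψ : StrongDual ℝ (Lp ℝ 2 μ) :=
    LinearMap.mkContinuous (φ.toLinearMap ∘ₗ W.mkQ ∘ₗ lpTwoToLpOne μ) 1 fun h => by
      rw [one_mul]
      exact (hφ1 h).trans (norm_lpTwoToLpOne_le h)
  have hψ : ∀ h, ψ h = φ (W.mkQ (lpTwoToLpOne μ h)) := fun h => rfl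
  -- A norming functional of the quotient of `L¹` by the image of `V` is pulled back to `L²`, where
  -- Riesz represents it by a function.
  set G : Lp ℝ 2 μ := (InnerProductSpace.toDual ℝ _).symm ψ with hG
  have hGψ : ∀ h, inner ℝ G h = ψ h := fun h => InnerProductSpace.toDual_symm_apply
  have hGi : Integrable G μ := (Lp.memLp G).integrable (by norm_num)
  -- Testing against indicators turns the `L¹`-bound on the functional into `|G| ≤ 1` almost
  -- everywhere.
  have hset : ∀ s, MeasurableSet s → |∫ x in s, G x ∂μ| ≤ μ.real s := by
    intro s hs
    have hmem : MemLp (s.indicator fun _ => (1 : ℝ)) 2 μ :=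
      memLp_indicator_const 2 hs 1 (Or.inr (measure_ne_top μ s))
    have h1 : ∫ x in s, G x ∂μ = ψ (hmem.toLp _) := by
      rw [← hGψ, ← Lp.toLp_coeFn G (Lp.memLp G), inner_toLp_eq_integral, ← integral_indicator hs]
      refine integral_congr_ae ?_
      refine ae_of_all _ fun x => ?_
      by_cases hxs : x ∈ s <;> simp [hxs]
    rw [h1, hψ]
    refine (hφ1 _).trans_eq ?_
    rw [norm_lpTwoToLpOne, eLpNorm_congr_ae hmem.coeFn_toLp, eLpNorm_indicator_const hs (by simp)
      (by simp)]
    simp [Measure.real]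
  have hle : G ≤ᵐ[μ] fun _ => (1 : ℝ) :=
    ae_le_of_forall_setIntegral_le hGi (integrable_const _) fun s hs _ => by
      simpa using (abs_le.mp (hset s hs)).2
  have hge : (fun _ => (-1 : ℝ)) ≤ᵐ[μ] G :=
    ae_le_of_forall_setIntegral_le (integrable_const _) hGi fun s hs _ => by
      simpa using (abs_le.mp (hset s hs)).1
  obtain ⟨g₀, hg₀, hGg₀⟩ := Lp.aestronglyMeasurable G
  -- Clipping changes `G` only on a null set and makes the bound hold everywhere, as needed for
  -- label probabilities.
  let g : α → ℝ := fun x => max (-1) (min 1 (g₀ x))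
  have hgG : G =ᵐ[μ] g := by
    filter_upwards [hle, hge, hGg₀] with x h1 h2 h3
    simp only [g]
    rw [← h3, min_eq_right h1, max_eq_right h2]
  have hcorr : ∀ {h : α → ℝ} (hh : MemLp h 2 μ), ∫ x, g x * h x ∂μ = ψ (hh.toLp h) := by
    intro h hh
    rw [← hGψ, ← Lp.toLp_coeFn G (Lp.memLp G), inner_toLp_eq_integral]
    refine integral_congr_ae ?_
    filter_upwards [hgG] with x hx
    rw [hx]
  refine ⟨g, measurable_const.max (measurable_const.min hg₀.measurable), fun x => ?_, ?_, ?_⟩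
  · rw [abs_le]
    exact ⟨le_max_left _ _, max_le (by norm_num) (min_le_left _ _)⟩
  · intro v hv
    rw [hcorr (Lp.memLp v), Lp.toLp_coeFn, hψ]
    have : W.mkQ (lpTwoToLpOne μ v) = 0 := by
      rw [Submodule.mkQ_apply, Submodule.Quotient.mk_eq_zero]
      exact ⟨v, hv, rfl⟩
    rw [this, map_zero]
  · simp_rw [mul_comm (f _)]
    rw [hcorr hf, hψ, hφf]
    change ε ≤ ‖Submodule.Quotient.mk (lpTwoToLpOne μ (hf.toLp f))‖
    refine QuotientAddGroup.le_norm_iff.mpr fun u hu => ?_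
    have hu' : lpTwoToLpOne μ (hf.toLp f) - u ∈ W := by
      rw [← Submodule.Quotient.eq]; exact hu.symm
    obtain ⟨v, hv, hvu⟩ := hu'
    obtain rfl : u = lpTwoToLpOne μ (hf.toLp f - v) := by
      rw [map_sub, hvu, sub_sub_cancel]
    rw [norm_lpTwoToLpOne]
    refine (hV v hv).trans_eq (congrArg _ (eLpNorm_congr_ae ?_))
    filter_upwards [Lp.coeFn_sub (hf.toLp f) v, hf.coeFn_toLp] with x h1 h2
    rw [h1, Pi.sub_apply, Pi.sub_apply, h2]

/-- A function without a good `L¹`-approximation by polynomials of degree less than `d` correlates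
with a bounded function orthogonal to these polynomials. -/
theorem exists_bounded_orthogonal_of_not_hasL1Approx {m d : ℕ} {f : (Fin m → ℝ) → ℝ} {ε : ℝ}
    (hf : MemLp f 2 (gaussN m)) (hd : ¬ HasL1Approx f ε d) :
    ∃ g : (Fin m → ℝ) → ℝ, Measurable g ∧ (∀ x, |g x| ≤ 1) ∧
      (∀ q ∈ polyDegLT m (d + 1), ∫ x, g x * MvPolynomial.eval x q ∂(gaussN m) = 0) ∧
      ε ≤ ∫ x, f x * g x ∂(gaussN m) := by
  obtain ⟨g, hgm, hg1, hg, hfg⟩ := exists_bounded_annihilator (ε := ε) hf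
    ((polyDegLT m (d + 1)).map (polyToLp m)) (by
      rintro _ ⟨q, hq, rfl⟩
      have hq2 := memLp_two_eval_gaussN q
      have hn : ENNReal.ofReal ε ≤
          eLpNorm (fun x => f x - MvPolynomial.eval x q) 1 (gaussN m) := by
        by_contra! h
        exact hd ⟨q, totalDegree_le_of_mem_polyDegLT hq, h⟩
      have hfin := ((hf.sub hq2).mono_exponent (p := 1) (by norm_num)).eLpNorm_ne_top
      have he : eLpNorm (f - (polyToLp m q : (Fin m → ℝ) → ℝ)) 1 (gaussN m) =
          eLpNorm (fun x => f x - MvPolynomial.eval x q) 1 (gaussN m) := by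
        refine eLpNorm_congr_ae ?_
        filter_upwards [hq2.coeFn_toLp] with x hx
        rw [Pi.sub_apply, polyToLp_apply, hx]
      rw [he]
      exact (ENNReal.ofReal_le_iff_le_toReal hfin).mp hn)
  refine ⟨g, hgm, hg1, fun q hq => ?_, hfg⟩
  rw [← hg _ ⟨q, hq, rfl⟩]
  refine integral_congr_ae ?_
  filter_upwards [(memLp_two_eval_gaussN q).coeFn_toLp] with x hx
  rw [polyToLp_apply, hx]

/-! ### Nearly orthogonal families -/

open scoped RealInnerProductSpace in
/-- A vector correlates well with few members of a nearly orthogonal family. -/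
theorem card_le_of_nearly_orthogonal {E ι : Type*} [NormedAddCommGroup E] [InnerProductSpace ℝ E]
    {g : ι → E} {δ θ : ℝ} (hθ : 0 < θ) (hδ : 2 * δ ≤ θ ^ 2) (hg : ∀ i, ‖g i‖ ≤ 1)
    (hgg : ∀ i j, i ≠ j → |⟪g i, g j⟫| ≤ δ) (q : E) (S : Finset ι)
    (hS : ∀ i ∈ S, θ * ‖q‖ ≤ |⟪q, g i⟫| ∧ ⟪q, g i⟫ ≠ 0) : (S.card : ℝ) ≤ 2 / θ ^ 2 := by
  classical
  rcases S.eq_empty_or_nonempty with rfl | ⟨i₀, hi₀⟩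
  · simp only [Finset.card_empty, Nat.cast_zero]; positivity
  have hq : 0 < ‖q‖ := norm_pos_iff.mpr fun h => (hS i₀ hi₀).2 (by simp [h])
  -- Test `q` against the signed sum `v`: Cauchy–Schwarz gives `|S| θ ≤ ‖v‖`, near orthogonality
  -- gives `‖v‖² ≤ |S| + |S|² θ²/2`. Comparing the two bounds `|S|`.
  let s : ι → ℝ := fun i => SignType.sign ⟪q, g i⟫
  have hs : ∀ i, |s i| ≤ 1 := fun i => by
    rcases lt_trichotomy ⟪q, g i⟫ 0 with h | h | h <;> simp [s, h]
  have hss : ∀ i, s i * ⟪q, g i⟫ = |⟪q, g i⟫| := fun i => sign_mul_self _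
  set v := ∑ i ∈ S, s i • g i with hv
  have h1 : S.card * θ * ‖q‖ ≤ ‖q‖ * ‖v‖ := by
    refine le_trans ?_ (real_inner_le_norm q v)
    rw [hv, inner_sum]
    simp_rw [real_inner_smul_right, hss]
    rw [mul_assoc, ← nsmul_eq_mul]
    exact Finset.card_nsmul_le_sum _ _ _ fun i hi => (hS i hi).1
  have h2 : S.card * θ ≤ ‖v‖ := by
    rw [mul_comm ‖q‖] at h1
    exact le_of_mul_le_mul_right h1 hq
  have h3 : ‖v‖ ^ 2 ≤ S.card + S.card ^ 2 * (θ ^ 2 / 2) := by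
    have hterm : ∀ i j, ⟪s i • g i, s j • g j⟫ ≤ (if i = j then 1 else 0) + θ ^ 2 / 2 := by
      intro i j
      rw [real_inner_smul_left, real_inner_smul_right, ← mul_assoc]
      have hsij : |s i * s j| ≤ 1 := by
        rw [abs_mul]; exact mul_le_one₀ (hs i) (abs_nonneg _) (hs j)
      have habs : s i * s j * ⟪g i, g j⟫ ≤ |⟪g i, g j⟫| := by
        refine (le_abs_self _).trans ?_
        rw [abs_mul]
        exact mul_le_of_le_one_left (abs_nonneg _) hsij
      refine habs.trans ?_
      split_ifs with hij
      · subst hij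
        rw [abs_of_nonneg real_inner_self_nonneg, real_inner_self_eq_norm_sq]
        have := pow_le_one₀ (n := 2) (norm_nonneg _) (hg i)
        nlinarith
      · linarith [hgg i j hij]
    calc ‖v‖ ^ 2 = ∑ i ∈ S, ∑ j ∈ S, ⟪s i • g i, s j • g j⟫ := by
          rw [← real_inner_self_eq_norm_sq, hv, sum_inner]
          simp_rw [inner_sum]
      _ ≤ ∑ i ∈ S, ∑ j ∈ S, ((if i = j then 1 else 0) + θ ^ 2 / 2) :=
          Finset.sum_le_sum fun i _ => Finset.sum_le_sum fun j _ => hterm i j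
      _ = S.card + S.card ^ 2 * (θ ^ 2 / 2) := by
          simp only [Finset.sum_add_distrib, Finset.sum_ite_eq, Finset.sum_const, nsmul_eq_mul]
          rw [Finset.sum_congr rfl fun i hi => if_pos hi]
          simp
          ring
  have hS0 : (0 : ℝ) < S.card := by exact_mod_cast Finset.card_pos.mpr ⟨i₀, hi₀⟩
  have h4 : (S.card * θ) ^ 2 ≤ ‖v‖ ^ 2 := pow_le_pow_left₀ (by positivity) h2 2
  rw [le_div_iff₀ (by positivity)]
  have h5 : S.card * (S.card * θ ^ 2) ≤ S.card * 2 := by nlinarith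
  exact le_of_mul_le_mul_left h5 hS0

/-! ### Two-valued labels with prescribed conditional mean -/

/-- The law of `(x, y)` where `x` has law `μ` and `y ∈ {B, -B}` has conditional mean `B g(x)`. -/
noncomputable def signedLabels {X : Type*} [MeasurableSpace X] (μ : Measure X) (g : X → ℝ)
    (B : ℝ) : Measure (X × ℝ) :=
  (μ.withDensity fun x => ENNReal.ofReal ((1 + g x) / 2)).map (fun x => (x, B)) +
    (μ.withDensity fun x => ENNReal.ofReal ((1 - g x) / 2)).map (fun x => (x, -B))

section signedLabels

variable {X : Type*} [MeasurableSpace X] {μ : Measure X} {g : X → ℝ} {B : ℝ}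

theorem map_fst_signedLabels (hg : Measurable g) (hg1 : ∀ x, |g x| ≤ 1) :
    (signedLabels μ g B).map Prod.fst = μ := by
  rw [signedLabels, Measure.map_add _ _ measurable_fst, Measure.map_map (by fun_prop) (by fun_prop),
    Measure.map_map (by fun_prop) (by fun_prop)]
  change Measure.map id _ + Measure.map id _ = μ
  rw [Measure.map_id, Measure.map_id, ← withDensity_add_left (by fun_prop)]
  convert withDensity_one using 2
  ext x
  rw [Pi.add_apply, ← ENNReal.ofReal_add (by linarith [(abs_le.mp (hg1 x)).1])
    (by linarith [(abs_le.mp (hg1 x)).2])]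
  norm_num
  ring

theorem isProbabilityMeasure_signedLabels [IsProbabilityMeasure μ] (hg : Measurable g)
    (hg1 : ∀ x, |g x| ≤ 1) : IsProbabilityMeasure (signedLabels μ g B) := by
  constructor
  have h := map_fst_signedLabels (μ := μ) (B := B) hg hg1
  rw [← Set.preimage_univ (f := (Prod.fst : X × ℝ → X)), ← Measure.map_apply measurable_fst
    MeasurableSet.univ, h, measure_univ]

theorem ae_snd_signedLabels : ∀ᵐ z ∂(signedLabels μ g B), z.2 = B ∨ z.2 = -B := by
  have hs : MeasurableSet {z : X × ℝ | z.2 = B ∨ z.2 = -B} :=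
    (measurable_snd (measurableSet_singleton B)).union
      (measurable_snd (measurableSet_singleton (-B)))
  rw [signedLabels, ae_add_measure_iff, ae_map_iff (by fun_prop) hs, ae_map_iff (by fun_prop) hs]
  simp

theorem integral_signedLabels (hg : Measurable g) (hg1 : ∀ x, |g x| ≤ 1) {φ : X × ℝ → ℝ}
    (hφ : Measurable φ) (h1 : Integrable (fun x => φ (x, B)) μ)
    (h2 : Integrable (fun x => φ (x, -B)) μ) :
    ∫ z, φ z ∂(signedLabels μ g B) =
      ∫ x, ((1 + g x) / 2 * φ (x, B) + (1 - g x) / 2 * φ (x, -B)) ∂μ := by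
  have hp : ∀ x, 0 ≤ (1 + g x) / 2 := fun x => by linarith [(abs_le.mp (hg1 x)).1]
  have hn : ∀ x, 0 ≤ (1 - g x) / 2 := fun x => by linarith [(abs_le.mp (hg1 x)).2]
  have hp1 : ∀ x, ‖(1 + g x) / 2‖ ≤ 1 := fun x => by
    rw [Real.norm_of_nonneg (hp x)]; linarith [(abs_le.mp (hg1 x)).2]
  have hn1 : ∀ x, ‖(1 - g x) / 2‖ ≤ 1 := fun x => by
    rw [Real.norm_of_nonneg (hn x)]; linarith [(abs_le.mp (hg1 x)).1]
  have i1 : Integrable (fun x => (1 + g x) / 2 * φ (x, B)) μ :=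
    h1.bdd_mul (by fun_prop) (ae_of_all _ hp1)
  have i2 : Integrable (fun x => (1 - g x) / 2 * φ (x, -B)) μ :=
    h2.bdd_mul (by fun_prop) (ae_of_all _ hn1)
  have hB : ∀ b : ℝ, Measurable fun x : X => (x, b) := fun b => by fun_prop
  have e1 : ∀ (w : X → ℝ) (hw : Measurable w) (hw0 : ∀ x, 0 ≤ w x) (b : ℝ),
      Integrable (fun x => w x * φ (x, b)) μ →
      Integrable φ ((μ.withDensity fun x => ENNReal.ofReal (w x)).map (fun x => (x, b))) ∧
      ∫ z, φ z ∂((μ.withDensity fun x => ENNReal.ofReal (w x)).map (fun x => (x, b))) =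
        ∫ x, w x * φ (x, b) ∂μ := by
    intro w hw hw0 b hi
    constructor
    · rw [integrable_map_measure hφ.aestronglyMeasurable (hB b).aemeasurable,
        integrable_withDensity_iff_integrable_smul' (by fun_prop) (by simp)]
      refine hi.congr (ae_of_all _ fun x => ?_)
      simp [ENNReal.toReal_ofReal (hw0 x)]
    · rw [integral_map (hB b).aemeasurable hφ.aestronglyMeasurable,
        integral_withDensity_eq_integral_toReal_smul (by fun_prop) (by simp)]
      refine integral_congr_ae (ae_of_all _ fun x => ?_)
      simp [ENNReal.toReal_ofReal (hw0 x)]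
  obtain ⟨j1, k1⟩ := e1 _ (by fun_prop) hp B i1
  obtain ⟨j2, k2⟩ := e1 _ (by fun_prop) hn (-B) i2
  rw [signedLabels, integral_add_measure j1 j2, k1, k2, integral_add i1 i2]

variable [IsProbabilityMeasure μ]

/-- The part of a query even in the label has the same mean under both distributions; only the odd
part sees `g`. -/
theorem integral_query_signedLabels (hg : Measurable g) (hg1 : ∀ x, |g x| ≤ 1)
    (q : StatQuery X) :
    ∫ z, q.toFun z ∂(signedLabels μ g B) - ∫ z, q.toFun z ∂(signedLabels μ 0 B) =
      ∫ x, (q.toFun (x, B) - q.toFun (x, -B)) / 2 * g x ∂μ := by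
  have hq : ∀ b : ℝ, Integrable (fun x => q.toFun (x, b)) μ := fun b =>
    Integrable.of_bound (q.measurable.comp (by fun_prop)).aestronglyMeasurable 1
      (ae_of_all _ fun x => q.bounded _)
  have hgq : ∀ b : ℝ, Integrable (fun x => g x * q.toFun (x, b)) μ := fun b =>
    (hq b).bdd_mul hg.aestronglyMeasurable (ae_of_all _ hg1)
  rw [integral_signedLabels hg hg1 q.measurable (hq _) (hq _),
    integral_signedLabels measurable_zero (by simp) q.measurable (hq _) (hq _), ← integral_sub]
  · refine integral_congr_ae (ae_of_all _ fun x => ?_)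
    simp only [Pi.zero_apply]
    ring
  · refine ((((hq B).add (hq (-B))).div_const 2).add
      (((hgq B).sub (hgq (-B))).div_const 2)).congr (ae_of_all _ fun x => ?_)
    simp only [Pi.add_apply, Pi.sub_apply]
    ring
  · refine (((hq B).add (hq (-B))).div_const 2).congr (ae_of_all _ fun x => ?_)
    simp only [Pi.add_apply, Pi.zero_apply]
    ring

theorem memLp_label_signedLabels (hg : Measurable g) (hg1 : ∀ x, |g x| ≤ 1) :
    MemLp (fun z : X × ℝ => z.2) 2 (signedLabels μ g B) := by
  have := isProbabilityMeasure_signedLabels (μ := μ) (B := B) hg hg1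
  refine MemLp.of_bound measurable_snd.aestronglyMeasurable |B| ?_
  filter_upwards [ae_snd_signedLabels (μ := μ) (g := g) (B := B)] with z hz
  rcases hz with hz | hz <;> simp [hz]

/-- Labels are bounded, so finite error forces the hypothesis itself into `L²`. -/
theorem memLp_of_l2Err_signedLabels_lt_top (hg : Measurable g) (hg1 : ∀ x, |g x| ≤ 1) {h : X → ℝ}
    (hm : Measurable h) (hh : l2Err (signedLabels μ g B) h < ∞) : MemLp h 2 μ := by
  have h1 : MemLp (fun z : X × ℝ => h z.1 - z.2) 2 (signedLabels μ g B) :=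
    ⟨((hm.comp measurable_fst).sub measurable_snd).aestronglyMeasurable, hh⟩
  have h2 := h1.add (memLp_label_signedLabels hg hg1)
  have h3 : MemLp (h ∘ Prod.fst) 2 (signedLabels μ g B) := by
    convert h2 using 1
    ext z
    simp
  rw [← map_fst_signedLabels (μ := μ) (B := B) hg hg1]
  exact (memLp_map_measure_iff hm.aestronglyMeasurable measurable_fst.aemeasurable).mpr h3

/-- Expand the square, using `y² = B²` and `E[y | x] = B g(x)`. -/
theorem l2Err_signedLabels (hg : Measurable g) (hg1 : ∀ x, |g x| ≤ 1) {h : X → ℝ}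
    (hm : Measurable h) (hh : MemLp h 2 μ) :
    l2Err (signedLabels μ g B) h ≠ ∞ ∧ (l2Err (signedLabels μ g B) h).toReal ^ 2 =
      ∫ x, h x ^ 2 ∂μ - 2 * B * ∫ x, h x * g x ∂μ + B ^ 2 := by
  have h1 : MemLp (fun z : X × ℝ => h z.1 - z.2) 2 (signedLabels μ g B) :=
    (hh.comp_measurePreserving ⟨measurable_fst, map_fst_signedLabels hg hg1⟩).sub
      (memLp_label_signedLabels hg hg1)
  refine ⟨h1.eLpNorm_ne_top, ?_⟩
  have hi2 : Integrable (fun x => h x ^ 2) μ := hh.integrable_sq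
  have hi1 : Integrable h μ := hh.integrable (by norm_num)
  have hig : Integrable (fun x => h x * g x) μ :=
    hi1.mul_bdd (c := 1) hg.aestronglyMeasurable (ae_of_all _ hg1)
  have hib : ∀ b : ℝ, Integrable (fun x => (h x - b) ^ 2) μ := fun b =>
    (hh.sub (memLp_const b)).integrable_sq
  rw [l2Err, ← Lp.norm_toLp _ h1, norm_toLp_sq_eq_integral,
    integral_signedLabels hg hg1 (by fun_prop) (hib _) (hib _)]
  have : ∀ x, (1 + g x) / 2 * (h x - B) ^ 2 + (1 - g x) / 2 * (h x - -B) ^ 2 =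
      h x ^ 2 - 2 * B * (h x * g x) + B ^ 2 := fun x => by ring
  simp_rw [this]
  have hd : Integrable (fun x => h x ^ 2 - 2 * B * (h x * g x)) μ := hi2.sub (hig.const_mul _)
  rw [integral_add hd (integrable_const _), integral_sub hi2 (hig.const_mul _),
    integral_const_mul]
  simp

/-- A hypothesis whose error is competitive with a concept correlated with `g` correlates with `g`
itself. -/
theorem correlation_of_l2Err_le {κ ε : ℝ} (hκ : 0 < κ) (hκ' : κ < 1) (hε : 0 < ε) (hε' : ε ≤ 1)
    (hB : B = 1 / ((1 - κ) * ε)) (hg : Measurable g) (hg1 : ∀ x, |g x| ≤ 1) {f h : X → ℝ}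
    (hfm : Measurable f) (hf : MemLp f 2 μ) (hf1 : ∫ x, f x ^ 2 ∂μ = 1)
    (hfg : ε ≤ ∫ x, f x * g x ∂μ) (hm : Measurable h)
    (hle : l2Err (signedLabels μ g B) h ≤
      l2Err (signedLabels μ g B) f + ENNReal.ofReal (κ * ε)) :
    MemLp h 2 μ ∧ 3 / 4 + ∫ x, h x ^ 2 ∂μ ≤ 2 * B * ∫ x, h x * g x ∂μ := by
  obtain ⟨hft, hfe⟩ := l2Err_signedLabels (B := B) hg hg1 hfm hf
  have hfin : l2Err (signedLabels μ g B) f + ENNReal.ofReal (κ * ε) ≠ ∞ :=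
    ENNReal.add_ne_top.mpr ⟨hft, ENNReal.ofReal_ne_top⟩
  have hh : MemLp h 2 μ := memLp_of_l2Err_signedLabels_lt_top hg hg1 hm
    (lt_of_le_of_lt hle hfin.lt_top)
  refine ⟨hh, ?_⟩
  obtain ⟨hht, hhe⟩ := l2Err_signedLabels (B := B) hg hg1 hm hh
  have hle' := ENNReal.toReal_mono hfin hle
  rw [ENNReal.toReal_add hft ENNReal.ofReal_ne_top, ENNReal.toReal_ofReal (by positivity)] at hle'
  set eh := (l2Err (signedLabels μ g B) h).toReal
  set ef := (l2Err (signedLabels μ g B) f).toReal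
  have hef0 : 0 ≤ ef := ENNReal.toReal_nonneg
  have heh0 : 0 ≤ eh := ENNReal.toReal_nonneg
  have h1κ : 0 < 1 - κ := by linarith
  have hBδ : B * ((1 - κ) * ε) = 1 := by rw [hB]; field_simp
  set δ := (1 - κ) * ε / 2 with hδ
  have hδ0 : 0 < δ := by positivity
  have hδ1 : δ ≤ 1 / 2 := by
    have : (1 - κ) * ε ≤ 1 * 1 := mul_le_mul (by linarith) hε' hε.le (by norm_num)
    linarith
  have hB1 : 1 ≤ B := by
    by_contra! hlt
    have : B * ((1 - κ) * ε) < 1 * ((1 - κ) * ε) := mul_lt_mul_of_pos_right hlt (by positivity)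
    linarith
  have h2Bδ : 2 * B * δ = 1 := by rw [hδ]; linarith
  -- Since `2Bδ = 1`, the square of the right side is `B² - 2Bε + 1 + (δ - ε)²`, which dominates `1
  -- - 2B ∫ f g + B²`.
  have hef : ef ≤ B - ε + δ := by
    refine le_of_sq_le_sq ?_ (by linarith)
    rw [hfe, hf1]
    have : B * ε ≤ B * ∫ x, f x * g x ∂μ := mul_le_mul_of_nonneg_left hfg (by linarith)
    nlinarith [sq_nonneg (δ - ε)]
  -- After the slack `κε` a gain of `δ` over the zero hypothesis (error `B`) remains. Squared, it is
  -- worth `2Bδ - δ² ≥ 3/4`.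
  have heh : eh ≤ B - δ := by
    have : ε - κ * ε = 2 * δ := by rw [hδ]; ring
    linarith
  have := pow_le_pow_left₀ heh0 heh 2
  rw [hhe] at this
  nlinarith

end signedLabels

/-! ### Projections from codes -/

section blockProjection

variable {m n p : ℕ} [NeZero p] (e : Fin m × ZMod p × ZMod p ↪ Fin n)

/-- The projection whose `i`-th coordinate averages the coordinates indexed by the graph of `φ` in
the `i`-th block. -/
noncomputable def blockProjection (φ : ZMod p → ZMod p) : Matrix (Fin m) (Fin n) ℝ :=
  fun i j => ∑ t, if j = e (i, t, φ t) then (√p)⁻¹ else 0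

/-- Rows are normalized indicators of graphs in disjoint blocks, so the product counts agreements of
`φ` and `ψ`. Repeating the same function in every block is what makes it a scalar matrix. -/
theorem blockProjection_mul_transpose (φ ψ : ZMod p → ZMod p) :
    blockProjection e φ * (blockProjection e ψ)ᵀ =
      (((Finset.univ.filter fun t => φ t = ψ t).card : ℝ) / p) •
        (1 : Matrix (Fin m) (Fin m) ℝ) := by
  ext i i'
  have hsq : (√(p : ℝ))⁻¹ * (√p)⁻¹ = (p : ℝ)⁻¹ := by
    rw [← mul_inv, Real.mul_self_sqrt (Nat.cast_nonneg p)]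
  have h1 : ∀ t t' : ZMod p, ∑ j, (if j = e (i, t, φ t) then (√(p : ℝ))⁻¹ else 0) *
      (if j = e (i', t', ψ t') then (√p)⁻¹ else 0) =
      if i = i' then (if t = t' then (if φ t = ψ t then (p : ℝ)⁻¹ else 0) else 0) else 0 := by
    intro t t'
    simp only [ite_mul, zero_mul, Finset.sum_ite_eq', Finset.mem_univ, if_true, mul_ite, mul_zero,
      hsq, EmbeddingLike.apply_eq_iff_eq, Prod.mk.injEq]
    grind
  have h2 : (blockProjection e φ * (blockProjection e ψ)ᵀ) i i' =
      ∑ t, ∑ t', ∑ j, (if j = e (i, t, φ t) then (√(p : ℝ))⁻¹ else 0) *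
        (if j = e (i', t', ψ t') then (√p)⁻¹ else 0) := by
    simp only [Matrix.mul_apply, Matrix.transpose_apply, blockProjection, Finset.sum_mul_sum]
    rw [Finset.sum_comm]
    exact Finset.sum_congr rfl fun t _ => Finset.sum_comm
  rw [h2]
  simp_rw [h1]
  by_cases hi : i = i'
  · subst hi
    simp [← Finset.sum_filter, div_eq_mul_inv]
  · simp [hi]

end blockProjection

/-- Exponentially many nearly orthogonal projections, built from Reed–Solomon codes. -/
theorem exists_nearly_orthogonal_projections {m n p D : ℕ} [Fact p.Prime] (h : m * p ^ 2 ≤ n) :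
    ∃ P : (Fin D → ZMod p) → Matrix (Fin m) (Fin n) ℝ, (∀ v, P v * (P v)ᵀ = 1) ∧
      ∀ v w, v ≠ w → ∃ ρ : ℝ, 0 ≤ ρ ∧ ρ ≤ 1 ∧ ρ ≤ D / p ∧
        P v * (P w)ᵀ = ρ • (1 : Matrix (Fin m) (Fin m) ℝ) := by
  classical
  have hp : (0 : ℝ) < p := by exact_mod_cast (Fact.out : p.Prime).pos
  obtain ⟨e⟩ : Nonempty (Fin m × ZMod p × ZMod p ↪ Fin n) := by
    refine Function.Embedding.nonempty_of_card_le ?_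
    simpa [ZMod.card, sq] using h
  let F : (Fin D → ZMod p) → Polynomial (ZMod p) := fun v =>
    ((Polynomial.degreeLTEquiv (ZMod p) D).symm v : Polynomial.degreeLT (ZMod p) D)
  refine ⟨fun v => blockProjection e fun t => (F v).eval t, fun v => ?_, fun v w hvw => ?_⟩
  · rw [blockProjection_mul_transpose]
    simp [ZMod.card, hp.ne']
  · refine ⟨_, by positivity, ?_, ?_, blockProjection_mul_transpose e _ _⟩
    · rw [div_le_one hp]
      have := Finset.card_le_univ (Finset.univ.filter fun t => (F v).eval t = (F w).eval t)
      rw [ZMod.card] at this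
      exact_mod_cast this
    · have hne : F v - F w ≠ 0 := by
        rw [sub_ne_zero]
        intro heq
        exact hvw ((Polynomial.degreeLTEquiv (ZMod p) D).symm.injective (Subtype.ext heq))
      have hmem : F v - F w ∈ Polynomial.degreeLT (ZMod p) D :=
        sub_mem (Submodule.coe_mem _) (Submodule.coe_mem _)
      have hdeg : (F v - F w).natDegree ≤ D := by
        rw [Polynomial.mem_degreeLT] at hmem
        exact Polynomial.natDegree_le_of_degree_le hmem.le
      have hcard : (Finset.univ.filter fun t => (F v).eval t = (F w).eval t).card ≤ D := by
        refine le_trans (Finset.card_le_card fun t ht => ?_)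
          ((Multiset.toFinset_card_le _).trans ((Polynomial.card_roots' _).trans hdeg))
        rw [Multiset.mem_toFinset, Polynomial.mem_roots hne]
        simpa [sub_eq_zero] using ht
      gcongr

/-! ### Simulating an algorithm against the reference distribution -/

/-- An oracle which agrees with `O` on the queries asked under `O` leads to the same run. -/
theorem SQProc.exists_queries_run_eq {X : Type*} [MeasurableSpace X] (O : StatQuery X → ℝ)
    (A : SQProc X) : ∃ Q : List (StatQuery X), Q.length = A.numQueries O ∧
      ∀ O' : StatQuery X → ℝ, (∀ q ∈ Q, O' q = O q) → A.run O' = A.run O := by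
  induction A with
  | output h hh => exact ⟨[], rfl, fun _ _ => rfl⟩
  | ask q next ih =>
    obtain ⟨Q, hQ, hrun⟩ := ih (O q)
    refine ⟨q :: Q, by simp [hQ, SQProc.numQueries], fun O' h => ?_⟩
    simp only [SQProc.run]
    rw [h q (by simp)]
    exact hrun O' fun q' hq' => h q' (by simp [hq'])

theorem SQProc.measurable_run {X : Type*} [MeasurableSpace X] (O : StatQuery X → ℝ)
    (A : SQProc X) : Measurable (A.run O) := by
  induction A with
  | output h hh => exact hh
  | ask q next ih => exact ih (O q)

/-- An algorithm learning a large family of distributions, of which every query distinguishes few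
from a reference distribution and every hypothesis is good for few, asks many queries. -/
theorem makesQueries_of_agnosticallyLearns {n : ℕ} {Y : Set ℝ} {C : Set ((Fin n → ℝ) → ℝ)}
    {Ω : Type*} [MeasurableSpace Ω] {ν : Measure Ω} [IsProbabilityMeasure ν]
    {A : Ω → SQProc (Fin n → ℝ)} {η τ : ℝ} (hτ : 0 < τ) (hA : AgnosticallyLearns ν A C Y η τ)
    {ι : Type*} [Fintype ι] [Nonempty ι] {D : ι → Measure ((Fin n → ℝ) × ℝ)}
    {D₀ : Measure ((Fin n → ℝ) × ℝ)} (hD : ∀ i, IsGaussianExamples Y (D i))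
    (hD₀ : IsGaussianExamples Y D₀) {K K' N : ℝ} (hK : 0 ≤ K)
    (hquery : ∀ (q : StatQuery (Fin n → ℝ)) (S : Finset ι),
      (∀ i ∈ S, τ < |∫ z, q.toFun z ∂(D i) - ∫ z, q.toFun z ∂D₀|) → (S.card : ℝ) ≤ K)
    (hhyp : ∀ (h : (Fin n → ℝ) → ℝ), Measurable h → ∀ S : Finset ι,
      (∀ i ∈ S, l2Err (D i) h ≤ l2Opt (D i) C + ENNReal.ofReal η) → (S.card : ℝ) ≤ K')
    (hN : N * K + K' ≤ Fintype.card ι / 2) : MakesQueries A Y τ N := by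
  classical
  let O₀ : StatQuery (Fin n → ℝ) → ℝ := fun q => ∫ z, q.toFun z ∂D₀
  have hO₀ : IsStatOracle D₀ τ O₀ := fun q => by simpa [O₀] using hτ.le
  by_contra hcon
  have hlt : ∀ ω, ((A ω).numQueries O₀ : ℝ) < N := by
    intro ω
    by_contra! h
    exact hcon ⟨D₀, hD₀, O₀, hO₀, ω, h⟩
  -- The adversary gives the reference answer whenever the tolerance permits.
  let O : ι → StatQuery (Fin n → ℝ) → ℝ := fun i q =>
    if |O₀ q - ∫ z, q.toFun z ∂(D i)| ≤ τ then O₀ q else ∫ z, q.toFun z ∂(D i)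
  have hO : ∀ i, IsStatOracle (D i) τ (O i) := by
    intro i q
    by_cases h : |O₀ q - ∫ z, q.toFun z ∂(D i)| ≤ τ
    · simp [O, h]
    · simp [O, h, hτ.le]
  let good : ι → Ω → Prop := fun i ω =>
    l2Err (D i) ((A ω).run (O i)) ≤ l2Opt (D i) C + ENNReal.ofReal η
  -- For a fixed seed, an index either is separated from the reference by one of the fewer than `N`
  -- queries of the reference run, or sees the hypothesis of that run.
  have hgood : ∀ ω, ((Finset.univ.filter fun i => good i ω).card : ℝ) ≤ Fintype.card ι / 2 := by
    intro ω
    obtain ⟨Q, hQl, hQ⟩ := SQProc.exists_queries_run_eq O₀ (A ω)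
    let S₁ := Q.toFinset.biUnion fun q =>
      Finset.univ.filter fun i => τ < |∫ z, q.toFun z ∂(D i) - O₀ q|
    let S₂ := Finset.univ.filter fun i =>
      l2Err (D i) ((A ω).run O₀) ≤ l2Opt (D i) C + ENNReal.ofReal η
    have hsub : (Finset.univ.filter fun i => good i ω) ⊆ S₁ ∪ S₂ := by
      intro i hi
      by_cases h1 : i ∈ S₁
      · exact Finset.mem_union_left _ h1
      · refine Finset.mem_union_right _ ?_
        have hrun : (A ω).run (O i) = (A ω).run O₀ := by
          refine hQ _ fun q hq => ?_
          have : ¬ τ < |∫ z, q.toFun z ∂(D i) - O₀ q| := fun hlt => h1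
            (Finset.mem_biUnion.mpr ⟨q, List.mem_toFinset.mpr hq, by simpa using hlt⟩)
          rw [not_lt, abs_sub_comm] at this
          exact if_pos this
        have := (Finset.mem_filter.mp hi).2
        simp only [good, hrun] at this
        simpa [S₂] using this
    have h1 : (S₁.card : ℝ) ≤ N * K := by
      calc (S₁.card : ℝ) ≤ ∑ q ∈ Q.toFinset, ((Finset.univ.filter fun i =>
            τ < |∫ z, q.toFun z ∂(D i) - O₀ q|).card : ℝ) := by
            exact_mod_cast Finset.card_biUnion_le
        _ ≤ Q.toFinset.card * K := by
            rw [← nsmul_eq_mul]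
            exact Finset.sum_le_card_nsmul _ _ _ fun q _ => hquery q _ fun i hi =>
              (Finset.mem_filter.mp hi).2
        _ ≤ N * K := by
            refine mul_le_mul_of_nonneg_right ?_ hK
            refine le_trans ?_ (hlt ω).le
            rw [← hQl]
            exact_mod_cast List.toFinset_card_le Q
    have h2 : (S₂.card : ℝ) ≤ K' :=
      hhyp _ (SQProc.measurable_run O₀ (A ω)) _ fun i hi => (Finset.mem_filter.mp hi).2
    calc ((Finset.univ.filter fun i => good i ω).card : ℝ) ≤ ((S₁ ∪ S₂).card : ℝ) := by
          exact_mod_cast Finset.card_le_card hsub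
      _ ≤ S₁.card + S₂.card := by exact_mod_cast Finset.card_union_le _ _
      _ ≤ _ := by linarith
  -- Failure sets need not be measurable; measurable hulls keep their measure. Every seed fails on
  -- at least half the indices, against an average of at most one third.
  let bad : ι → Set Ω := fun i => toMeasurable ν {ω | ¬ good i ω}
  have hbadm : ∀ i, MeasurableSet (bad i) := fun i => measurableSet_toMeasurable _ _
  have hbad : ∀ i, ν (bad i) ≤ 1 / 3 := fun i => by
    rw [measure_toMeasurable]
    exact hA (D i) (hD i) (O i) (hO i)
  have hcount : ∀ ω, ENNReal.ofReal (Fintype.card ι / 2) ≤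
      ∑ i, (bad i).indicator (fun _ => (1 : ℝ≥0∞)) ω := by
    intro ω
    have hle : ∑ i, (if good i ω then 0 else (1 : ℝ≥0∞)) ≤
        ∑ i, (bad i).indicator (fun _ => (1 : ℝ≥0∞)) ω := by
      refine Finset.sum_le_sum fun i _ => ?_
      split_ifs with h
      · exact zero_le
      · rw [Set.indicator_of_mem (subset_toMeasurable ν {ω | ¬ good i ω} h)]
    refine le_trans ?_ hle
    have hsplit := Finset.card_filter_add_card_filter_not (s := (Finset.univ : Finset ι))
      (fun i => good i ω)
    rw [Finset.card_univ] at hsplit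
    have hsplit' : ((Finset.univ.filter fun i => good i ω).card : ℝ) +
        ((Finset.univ.filter fun i => ¬ good i ω).card : ℝ) = Fintype.card ι := by
      exact_mod_cast hsplit
    rw [Finset.sum_ite, Finset.sum_const_zero, zero_add, Finset.sum_const, nsmul_one]
    rw [← ENNReal.ofReal_natCast]
    exact ENNReal.ofReal_le_ofReal (by linarith [hgood ω])
  have hfinal : ENNReal.ofReal (Fintype.card ι / 2) ≤ Fintype.card ι * (1 / 3) := by
    calc ENNReal.ofReal (Fintype.card ι / 2)
        = ∫⁻ _, ENNReal.ofReal (Fintype.card ι / 2) ∂ν := by simp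
      _ ≤ ∫⁻ ω, ∑ i, (bad i).indicator (fun _ => (1 : ℝ≥0∞)) ω ∂ν := lintegral_mono hcount
      _ = ∑ i, ν (bad i) := by
          rw [lintegral_finsetSum _ fun i _ => measurable_const.indicator (hbadm i)]
          simp [lintegral_indicator_const (hbadm _)]
      _ ≤ ∑ _i : ι, (1 / 3 : ℝ≥0∞) := Finset.sum_le_sum fun i _ => hbad i
      _ = Fintype.card ι * (1 / 3) := by simp
  have hpos : (0 : ℝ) < Fintype.card ι := by exact_mod_cast Fintype.card_pos
  have h3 : (Fintype.card ι : ℝ≥0∞) * (1 / 3) = ENNReal.ofReal (Fintype.card ι / 3) := by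
    rw [ENNReal.ofReal_div_of_pos (by norm_num), ENNReal.ofReal_natCast, ENNReal.ofReal_ofNat,
      one_div, div_eq_mul_inv]
  rw [h3, ENNReal.ofReal_le_ofReal_iff (by positivity)] at hfinal
  linarith

/-! ### Numerical estimates for the code -/

/-- Bertrand's postulate above `y ^ 9`; the factor `y ≥ 4` absorbs the doubling and the rounding. -/
theorem exists_prime_between_pow {y : ℝ} (hy : 4 ≤ y) :
    ∃ p : ℕ, p.Prime ∧ y ^ 9 ≤ p ∧ (p : ℝ) ≤ y ^ 10 := by
  have h9 : 1 ≤ y ^ 9 := one_le_pow₀ (by linarith)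
  obtain ⟨p, hp, hlt, hle⟩ := Nat.exists_prime_lt_and_le_two_mul ⌈y ^ 9⌉₊
    (Nat.ceil_pos.mpr (by linarith)).ne'
  refine ⟨p, hp, (Nat.le_ceil _).trans (by exact_mod_cast hlt.le), ?_⟩
  have h1 : (⌈y ^ 9⌉₊ : ℝ) < y ^ 9 + 1 := Nat.ceil_lt_add_one (by linarith)
  have h2 : (p : ℝ) ≤ 2 * ⌈y ^ 9⌉₊ := by exact_mod_cast hle
  have h3 : y ^ 10 = y ^ 9 * y := pow_succ y 9
  nlinarith

/-- A code of dimension about `y ^ 3` over a field of size at least `y ^ 9` has many more than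
`2 ^ y y ^ (2 y)` words. -/
theorem two_rpow_mul_le_card_code {y κ : ℝ} (hy : 4 ≤ y) (hκ : κ ≤ y) {p D : ℕ} (hp : y ^ 9 ≤ p)
    (hD : y ^ 3 ≤ D + 1) :
    2 ^ y * (2 * y ^ (2 * y)) + κ * y ^ 2 ≤ ((p ^ D : ℕ) : ℝ) / 2 := by
  have hy0 : 0 < y := by linarith
  have hy1 : 1 ≤ y := by linarith
  have h1 : (2 : ℝ) ^ y ≤ y ^ y := Real.rpow_le_rpow (by norm_num) (by linarith) hy0.le
  have h2 : 2 ^ y * (2 * y ^ (2 * y)) ≤ y ^ (3 * y + 1) := by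
    have : y ^ (3 * y + 1) = y ^ y * (y * y ^ (2 * y)) := by
      rw [show 3 * y + 1 = y + (1 + 2 * y) by ring, Real.rpow_add hy0, Real.rpow_add hy0,
        Real.rpow_one]
    rw [this]
    gcongr
    linarith
  have h3 : κ * y ^ 2 ≤ y ^ (3 * y + 1) := by
    calc κ * y ^ 2 ≤ y * y ^ 2 := by gcongr
      _ = y ^ (3 : ℝ) := by
          rw [show (3 : ℝ) = ((3 : ℕ) : ℝ) by norm_num, Real.rpow_natCast]; ring
      _ ≤ y ^ (3 * y + 1) := Real.rpow_le_rpow_of_exponent_le hy1 (by linarith)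
  have h4 : 4 * y ^ (3 * y + 1) ≤ y ^ (3 * y + 2) := by
    rw [show 3 * y + 2 = 1 + (3 * y + 1) by ring, Real.rpow_add hy0 1, Real.rpow_one]
    gcongr
  have h5 : y ^ (3 * y + 2) ≤ ((p ^ D : ℕ) : ℝ) := by
    push_cast
    calc y ^ (3 * y + 2) ≤ y ^ ((9 * D : ℕ) : ℝ) := by
          refine Real.rpow_le_rpow_of_exponent_le hy1 ?_
          push_cast
          nlinarith [mul_nonneg hy0.le (sq_nonneg y)]
      _ = (y ^ 9) ^ D := by rw [Real.rpow_natCast, pow_mul]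
      _ ≤ (p : ℝ) ^ D := pow_le_pow_left₀ (by positivity) hp D
  linarith

/-! ### Counting distinguished instances and competitive hypotheses -/

section family

variable {n : ℕ} {κ ε δ τ B : ℝ} {ι : Type*} {g : ι → (Fin n → ℝ) → ℝ}

theorem isGaussianExamples_signedLabels {Y : Set ℝ} {g : (Fin n → ℝ) → ℝ} (hB : B ∈ Y)
    (hB' : -B ∈ Y) (hg : Measurable g) (hg1 : ∀ x, |g x| ≤ 1) :
    IsGaussianExamples Y (signedLabels (gaussN n) g B) where
  prob := isProbabilityMeasure_signedLabels hg hg1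
  marginal := map_fst_signedLabels hg hg1
  labels := by
    filter_upwards [ae_snd_signedLabels (μ := gaussN n) (g := g) (B := B)] with z hz
    rcases hz with hz | hz <;> rwa [hz]

theorem memLp_two_of_bounded {g : (Fin n → ℝ) → ℝ} (hg : Measurable g) (hg1 : ∀ x, |g x| ≤ 1) :
    MemLp g 2 (gaussN n) :=
  MemLp.of_bound hg.aestronglyMeasurable 1 (ae_of_all _ hg1)

theorem norm_toLp_le_one {g : (Fin n → ℝ) → ℝ} (hg : MemLp g 2 (gaussN n))
    (hg1 : ∀ x, |g x| ≤ 1) : ‖hg.toLp g‖ ≤ 1 := by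
  rw [← sq_le_one_iff₀ (norm_nonneg _), norm_toLp_sq_eq_integral]
  calc ∫ x, g x ^ 2 ∂(gaussN n) ≤ ∫ _, (1 : ℝ) ∂(gaussN n) :=
        integral_mono hg.integrable_sq (integrable_const _) fun x =>
          (sq_le_one_iff_abs_le_one _).mpr (hg1 x)
    _ = 1 := by simp

/-- The advantage of a query is the inner product of `g i` with the odd part of the query, a vector
of norm at most one. -/
theorem card_distinguished_le (hτ : 0 < τ) (hδ : 2 * δ ≤ τ ^ 2) (hg : ∀ i, Measurable (g i))
    (hg1 : ∀ i x, |g i x| ≤ 1)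
    (hgg : ∀ i j, i ≠ j → |∫ x, g i x * g j x ∂(gaussN n)| ≤ δ)
    (q : StatQuery (Fin n → ℝ)) (S : Finset ι)
    (hS : ∀ i ∈ S, τ < |∫ z, q.toFun z ∂(signedLabels (gaussN n) (g i) B) -
      ∫ z, q.toFun z ∂(signedLabels (gaussN n) 0 B)|) : (S.card : ℝ) ≤ 2 / τ ^ 2 := by
  have hg2 : ∀ i, MemLp (g i) 2 (gaussN n) := fun i => memLp_two_of_bounded (hg i) (hg1 i)
  have hq1 : ∀ x, |(q.toFun (x, B) - q.toFun (x, -B)) / 2| ≤ 1 := fun x => by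
    have h1 := abs_le.mp (q.bounded (x, B))
    have h2 := abs_le.mp (q.bounded (x, -B))
    rw [abs_le]
    constructor <;> linarith [h1.1, h1.2, h2.1, h2.2]
  have hqm : Measurable fun x => (q.toFun (x, B) - q.toFun (x, -B)) / 2 :=
    ((q.measurable.comp (by fun_prop : Measurable fun x : Fin n → ℝ => (x, B))).sub
      (q.measurable.comp (by fun_prop : Measurable fun x : Fin n → ℝ => (x, -B)))).div_const 2
  have hq2 := memLp_two_of_bounded hqm hq1
  refine card_le_of_nearly_orthogonal hτ hδ (fun i => norm_toLp_le_one (hg2 i) (hg1 i))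
    (fun i j hij => ?_) (hq2.toLp _) S fun i hi => ?_
  · rw [inner_toLp_eq_integral]
    exact hgg i j hij
  · rw [inner_toLp_eq_integral, ← integral_query_signedLabels (hg i) (hg1 i)]
    refine ⟨(mul_le_of_le_one_right hτ.le (norm_toLp_le_one hq2 hq1)).trans (hS i hi).le, ?_⟩
    exact abs_pos.mp (hτ.trans (hS i hi))

/-- The concept `F i` bounds the optimum from above, so a competitive `h` correlates with `g i`
beyond the threshold `(1 - κ)ε/2` times its norm, however large that norm is. -/
theorem card_competitive_le (hκ : 0 < κ) (hκ' : κ < 1) (hε : 0 < ε) (hε' : ε ≤ 1)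
    (hB : B = 1 / ((1 - κ) * ε)) (hδ : 2 * δ ≤ ((1 - κ) * ε / 2) ^ 2)
    (hg : ∀ i, Measurable (g i)) (hg1 : ∀ i x, |g i x| ≤ 1)
    (hgg : ∀ i j, i ≠ j → |∫ x, g i x * g j x ∂(gaussN n)| ≤ δ)
    {C : Set ((Fin n → ℝ) → ℝ)} {F : ι → (Fin n → ℝ) → ℝ} (hFC : ∀ i, F i ∈ C)
    (hFm : ∀ i, Measurable (F i)) (hF : ∀ i, MemLp (F i) 2 (gaussN n))
    (hF1 : ∀ i, ∫ x, F i x ^ 2 ∂(gaussN n) = 1)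
    (hFg : ∀ i, ε ≤ ∫ x, F i x * g i x ∂(gaussN n))
    (h : (Fin n → ℝ) → ℝ) (hm : Measurable h) (S : Finset ι)
    (hS : ∀ i ∈ S, l2Err (signedLabels (gaussN n) (g i) B) h ≤
      l2Opt (signedLabels (gaussN n) (g i) B) C + ENNReal.ofReal (κ * ε)) :
    (S.card : ℝ) ≤ 2 / ((1 - κ) * ε / 2) ^ 2 := by
  have h1κ : 0 < 1 - κ := by linarith
  have hg2 : ∀ i, MemLp (g i) 2 (gaussN n) := fun i => memLp_two_of_bounded (hg i) (hg1 i)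
  have hcorr : ∀ i ∈ S, MemLp h 2 (gaussN n) ∧ 3 / 4 + ∫ x, h x ^ 2 ∂(gaussN n) ≤
      2 * B * ∫ x, h x * g i x ∂(gaussN n) := fun i hi =>
    correlation_of_l2Err_le hκ hκ' hε hε' hB (hg i) (hg1 i) (hFm i) (hF i) (hF1 i) (hFg i) hm
      ((hS i hi).trans (add_le_add_left (iInf₂_le _ (hFC i)) _))
  rcases S.eq_empty_or_nonempty with rfl | ⟨i₀, hi₀⟩
  · simp only [Finset.card_empty, Nat.cast_zero]; positivity
  have hh := (hcorr i₀ hi₀).1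
  refine card_le_of_nearly_orthogonal (by positivity) hδ
    (fun i => norm_toLp_le_one (hg2 i) (hg1 i)) (fun i j hij => ?_) (hh.toLp h) S fun i hi => ?_
  · rw [inner_toLp_eq_integral]
    exact hgg i j hij
  · have key := (hcorr i hi).2
    rw [← norm_toLp_sq_eq_integral hh] at key
    rw [inner_toLp_eq_integral]
    set t := ‖hh.toLp h‖
    set c := ∫ x, h x * g i x ∂(gaussN n)
    have hBθ : 2 * B * ((1 - κ) * ε / 2) = 1 := by rw [hB]; field_simp
    set θ := (1 - κ) * ε / 2
    have hθ : 0 < θ := by positivity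
    have hc : θ * t < c := by
      -- From `t < 3/4 + t²`; this replaces the quadratic bound by one linear in the norm.
      have h1 : t < 2 * B * c := by nlinarith [sq_nonneg (t - 1 / 2)]
      calc θ * t < θ * (2 * B * c) := mul_lt_mul_of_pos_left h1 hθ
        _ = c := by linear_combination c * hBθ
    have hc0 : 0 < c := lt_of_le_of_lt (by positivity) hc
    exact ⟨hc.le.trans (le_abs_self c), hc0.ne'⟩

end family

/-! ### Choice of parameters and conclusion -/

theorem le_one_of_le_integral_mul {α : Type*} [MeasurableSpace α] {μ : Measure α}
    [IsProbabilityMeasure μ] {f g : α → ℝ} {ε : ℝ} (hf : MemLp f 2 μ)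
    (hf1 : ∫ x, f x ^ 2 ∂μ = 1) (hg : Measurable g) (hg1 : ∀ x, |g x| ≤ 1)
    (h : ε ≤ ∫ x, f x * g x ∂μ) : ε ≤ 1 := by
  refine h.trans ?_
  calc ∫ x, f x * g x ∂μ ≤ ∫ x, (f x ^ 2 + 1) / 2 ∂μ := by
        refine integral_mono ((hf.integrable (by norm_num)).mul_bdd (c := 1)
          hg.aestronglyMeasurable (ae_of_all _ hg1))
          ((hf.integrable_sq.add (integrable_const _)).div_const 2) fun x => ?_
        have := (sq_le_one_iff_abs_le_one _).mpr (hg1 x)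
        change f x * g x ≤ (f x ^ 2 + 1) / 2
        nlinarith [sq_nonneg (f x - g x)]
    _ = 1 := by
        rw [integral_div, integral_add hf.integrable_sq (integrable_const _), hf1]
        simp

theorem theorem1p6 (a κ : ℝ) (ha : 0 < a) (ha' : a < 1 / 2) (hκ : 0 < κ) (hκ' : κ < 1) :
    ∃ c > (0 : ℝ), ∃ c₁ > (0 : ℝ), ∃ c₂ > (0 : ℝ), ∃ n₀ : ℕ,
      ∀ (n m : ℕ), n₀ ≤ n → 1 ≤ n → 1 ≤ m → (m : ℝ) ≤ (n : ℝ) ^ a →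
      ∀ ε : ℝ, (n : ℝ) ^ (-c) ≤ ε →
      ∀ f : (Fin m → ℝ) → ℝ, Measurable f → ∫ x, f x ^ 2 ∂(gaussN m) = 1 →
      ∀ d : ℕ, IsLeast {k | HasL1Approx f ε k} d →
      ∀ C : Set ((Fin n → ℝ) → ℝ), (∀ F ∈ C, Measurable F) →
        (∀ P : Matrix (Fin m) (Fin n) ℝ, P * Pᵀ = 1 → (fun x => f (P *ᵥ x)) ∈ C) →
      ∀ Y : Set ℝ, Set.Icc (-(1 / ((1 - κ) * ε))) (1 / ((1 - κ) * ε)) ⊆ Y →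
      ∀ {Ω : Type*} [MeasurableSpace Ω] (ν : Measure Ω) [IsProbabilityMeasure ν]
        (A : Ω → SQProc (Fin n → ℝ)) (τ : ℝ), 0 < τ → τ ≤ 1 →
        AgnosticallyLearns ν A C Y (κ * ε) τ →
          τ ≤ (n : ℝ) ^ (-(c₁ * min (d : ℝ) ((n : ℝ) ^ c₂))) ∨
          MakesQueries A Y τ (2 ^ ((n : ℝ) ^ c₂)) := by
  have h1κ : 0 < 1 - κ := by linarith
  set Λ := 8 / (1 - κ) ^ 2 with hΛ
  have hΛ0 : 0 < Λ := by positivity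
  -- Everything is measured in `y = n^(1/40)`: `m ≤ y^20` and `p ≤ y^10` give `m p² ≤ y^40 = n`,
  -- while `ε ≥ 1/y`. The threshold on `n` makes `y` at least `4 + Λ`.
  refine ⟨1 / 40, by norm_num, 1 / 40, by norm_num, 1 / 40, by norm_num, ⌈(4 + Λ) ^ 40⌉₊, ?_⟩
  intro n m hn₀ hn1 hm1 hma ε hnε f hfm hf1 d hd C hC hPC Y hY Ω _ ν _ A τ hτ hτ1 hA
  have hn0 : (0 : ℝ) ≤ n := Nat.cast_nonneg n
  set y : ℝ := (n : ℝ) ^ (1 / 40 : ℝ) with hy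
  have hyn : y ^ 40 = n := by
    rw [hy, ← Real.rpow_natCast, ← Real.rpow_mul hn0]
    norm_num
  have hyΛ : 4 + Λ ≤ y := by
    have h1 : (4 + Λ) ^ 40 ≤ y ^ 40 := by
      rw [hyn]
      exact (Nat.le_ceil _).trans (by exact_mod_cast hn₀)
    exact le_of_pow_le_pow_left₀ (by norm_num) (by positivity) h1
  have hy4 : 4 ≤ y := by linarith
  have hy0 : 0 < y := by linarith
  have hy1 : 1 ≤ y := by linarith
  -- For `d = 0` the claimed bound is `τ ≤ n^0 = 1`.
  rcases Nat.eq_zero_or_pos d with rfl | hdpos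
  · left
    simpa [hy0.le] using hτ1
  by_cases hτn : τ ≤ (n : ℝ) ^ (-(1 / 40 * min (d : ℝ) y))
  · exact Or.inl hτn
  right
  rw [not_le, ← mul_neg, Real.rpow_mul hn0, ← hy] at hτn
  rw [Real.rpow_neg hn0, ← hy] at hnε
  set s := min (d : ℝ) y with hs
  have hs1 : 1 ≤ s := le_min (by exact_mod_cast hdpos) hy1
  have hε : 0 < ε := lt_of_lt_of_le (by positivity) hnε
  have hf2 : MemLp f 2 (gaussN m) := by
    rw [memLp_two_iff_integrable_sq hfm.aestronglyMeasurable]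
    -- A non-integrable square would have integral `0` by convention, not `1`.
    by_contra hni
    rw [integral_undef hni] at hf1
    norm_num at hf1
  -- The least degree is now `d + 1`, so approximation fails in degree `d`, and `g` is orthogonal to
  -- all polynomials of degree less than `d + 1`.
  obtain ⟨d, rfl⟩ := Nat.exists_eq_add_of_lt hdpos
  rw [zero_add] at hs hd
  have hnot : ¬ HasL1Approx f ε d := fun h => by
    have := hd.2 h
    omega
  obtain ⟨g, hgm, hg1, hgorth, hfg⟩ := exists_bounded_orthogonal_of_not_hasL1Approx hf2 hnot
  have hε1 : ε ≤ 1 := le_one_of_le_integral_mul hf2 hf1 hgm hg1 hfg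
  have hg2 := memLp_two_of_bounded hgm hg1
  obtain ⟨p, hp, hp9, hp10⟩ := exists_prime_between_pow hy4
  have : Fact p.Prime := ⟨hp⟩
  have hmp : m * p ^ 2 ≤ n := by
    have hm20 : (m : ℝ) ≤ y ^ 20 := by
      refine hma.trans ?_
      rw [hy, ← Real.rpow_natCast, ← Real.rpow_mul hn0]
      exact Real.rpow_le_rpow_of_exponent_le (by exact_mod_cast hn1) (by norm_num; linarith)
    have : (m : ℝ) * p ^ 2 ≤ n := by
      calc (m : ℝ) * p ^ 2 ≤ y ^ 20 * (y ^ 10) ^ 2 := by gcongr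
        _ = (n : ℝ) := by rw [← hyn]; ring
    exact_mod_cast this
  -- With `p ≥ y^9` this gives `ρ ≤ D/p ≤ y^(-6)`, and still leaves `p^D` far above `2^y y^(2y)`.
  set D := ⌊y ^ 3⌋₊ with hD
  have hDle : (D : ℝ) ≤ y ^ 3 := Nat.floor_le (by positivity)
  have hDge : y ^ 3 ≤ D + 1 := (Nat.lt_floor_add_one _).le
  obtain ⟨P, hP, hPP⟩ := exists_nearly_orthogonal_projections (D := D) hmp
  have hPmp : ∀ v, MeasurePreserving (fun x => P v *ᵥ x) (gaussN n) (gaussN m) := fun v =>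
    measurePreserving_mulVec_gaussN (hP v)
  have hcomp : ∀ v {F : (Fin m → ℝ) → ℝ}, Measurable F →
      ∫ x, F (P v *ᵥ x) ∂(gaussN n) = ∫ x, F x ∂(gaussN m) := fun v F hF => by
    rw [← (hPmp v).map_eq, integral_map (hPmp v).aemeasurable hF.aestronglyMeasurable]
  have hdecay : ∀ v w, v ≠ w →
      |∫ x, g (P v *ᵥ x) * g (P w *ᵥ x) ∂(gaussN n)| ≤ (y ^ (-s)) ^ 6 := by
    intro v w hvw
    obtain ⟨ρ, hρ0, hρ1, hρD, hρ⟩ := hPP v w hvw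
    have hρy : ρ ≤ (y ^ 6)⁻¹ := by
      refine hρD.trans ?_
      rw [div_le_iff₀ (lt_of_lt_of_le (by positivity) hp9)]
      calc (D : ℝ) ≤ y ^ 3 := hDle
        _ = (y ^ 6)⁻¹ * y ^ 9 := by field_simp
        _ ≤ (y ^ 6)⁻¹ * p := by gcongr
    have hgsq : ∫ x, g x ^ 2 ∂(gaussN m) ≤ 1 := by
      rw [← norm_toLp_sq_eq_integral hg2]
      exact pow_le_one₀ (norm_nonneg _) (norm_toLp_le_one hg2 hg1)
    calc |∫ x, g (P v *ᵥ x) * g (P w *ᵥ x) ∂(gaussN n)|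
        ≤ ρ ^ (d + 1) * ∫ x, g x ^ 2 ∂(gaussN m) :=
          abs_integral_mul_mulVec_le (hP v) (hP w) hρ hρ0 hρ1 hg2 hgorth
      _ ≤ ρ ^ (d + 1) := mul_le_of_le_one_right (by positivity) hgsq
      _ ≤ ((y ^ 6)⁻¹) ^ (d + 1) := pow_le_pow_left₀ hρ0 hρy _
      _ = (y ^ (-((d + 1 : ℕ) : ℝ))) ^ 6 := by
          rw [Real.rpow_neg hy0.le, Real.rpow_natCast, inv_pow, inv_pow, ← pow_mul, ← pow_mul,
            mul_comm]
      _ ≤ (y ^ (-s)) ^ 6 := by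
          refine pow_le_pow_left₀ (by positivity) (Real.rpow_le_rpow_of_exponent_le hy1 ?_) 6
          exact neg_le_neg (hs.trans_le (min_le_left _ _))
  set u := y ^ (-s) with hu
  have hu0 : 0 < u := by positivity
  have huy : u ≤ y⁻¹ := by
    rw [hu, ← Real.rpow_neg_one]
    exact Real.rpow_le_rpow_of_exponent_le hy1 (by linarith)
  have hu4 : u ≤ 1 / 4 := huy.trans (by
    rw [one_div]
    exact inv_anti₀ (by norm_num) hy4)
  -- The correlations are at most `u^6` while `τ > u`; the four spare powers of `u ≤ 1/4` absorb the
  -- factor two.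
  have hδτ : 2 * u ^ 6 ≤ τ ^ 2 := by
    have h1 : u ^ 2 ≤ τ ^ 2 := pow_le_pow_left₀ hu0.le hτn.le 2
    have h2 : u ^ 4 ≤ (1 / 4) ^ 4 := pow_le_pow_left₀ hu0.le hu4 4
    nlinarith [sq_nonneg u]
  have hθy : 2 / ((1 - κ) * ε / 2) ^ 2 ≤ Λ * y ^ 2 := by
    have h1 : (1 - κ) * y⁻¹ / 2 ≤ (1 - κ) * ε / 2 := by gcongr
    calc 2 / ((1 - κ) * ε / 2) ^ 2 ≤ 2 / ((1 - κ) * y⁻¹ / 2) ^ 2 := by gcongr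
      _ = Λ * y ^ 2 := by rw [hΛ]; field_simp; norm_num
  have hδθ : 2 * u ^ 6 ≤ ((1 - κ) * ε / 2) ^ 2 := by
    have hθ0 : 0 < ((1 - κ) * ε / 2) ^ 2 := by positivity
    have h1 : 2 ≤ Λ * y ^ 2 * ((1 - κ) * ε / 2) ^ 2 := (div_le_iff₀ hθ0).mp hθy
    have h2 : u ^ 6 * (Λ * y ^ 2) ≤ 1 := by
      calc u ^ 6 * (Λ * y ^ 2) ≤ (y⁻¹) ^ 6 * (y * y ^ 2) := by
            gcongr
            linarith
        _ = (y⁻¹) ^ 3 := by field_simp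
        _ ≤ 1 := pow_le_one₀ (by positivity) (inv_le_one_of_one_le₀ hy1)
    calc 2 * u ^ 6 ≤ (Λ * y ^ 2 * ((1 - κ) * ε / 2) ^ 2) * u ^ 6 := by gcongr
      _ = (u ^ 6 * (Λ * y ^ 2)) * ((1 - κ) * ε / 2) ^ 2 := by ring
      _ ≤ 1 * ((1 - κ) * ε / 2) ^ 2 := by gcongr
      _ = _ := one_mul _
  have hK : 2 / τ ^ 2 ≤ 2 * y ^ (2 * y) := by
    have h1 : u ^ 2 ≤ τ ^ 2 := pow_le_pow_left₀ hu0.le hτn.le 2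
    have h2 : y ^ (-(2 * y)) ≤ u ^ 2 := by
      rw [hu, ← Real.rpow_natCast, ← Real.rpow_mul hy0.le]
      refine Real.rpow_le_rpow_of_exponent_le hy1 ?_
      have : s ≤ y := min_le_right _ _
      push_cast
      linarith
    rw [div_eq_mul_inv]
    gcongr
    rw [← inv_inv (y ^ (2 * y)), ← Real.rpow_neg hy0.le]
    exact inv_anti₀ (by positivity) (h2.trans h1)
  have hB0 : 0 < 1 / ((1 - κ) * ε) := by positivity
  have hBY : 1 / ((1 - κ) * ε) ∈ Y := hY ⟨by linarith, le_rfl⟩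
  have hBY' : -(1 / ((1 - κ) * ε)) ∈ Y := hY ⟨le_rfl, by linarith⟩
  have hgPm : ∀ v, Measurable fun x => g (P v *ᵥ x) := fun v => hgm.comp (hPmp v).measurable
  refine makesQueries_of_agnosticallyLearns hτ hA
    (D := fun v => signedLabels (gaussN n) (fun x => g (P v *ᵥ x)) (1 / ((1 - κ) * ε)))
    (D₀ := signedLabels (gaussN n) 0 (1 / ((1 - κ) * ε)))
    (fun v => isGaussianExamples_signedLabels hBY hBY' (hgPm v) fun x => hg1 _)
    (isGaussianExamples_signedLabels hBY hBY' measurable_zero (by simp))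
    (K := 2 / τ ^ 2) (K' := 2 / ((1 - κ) * ε / 2) ^ 2) (by positivity)
    (fun q S hS => card_distinguished_le hτ hδτ hgPm (fun _ _ => hg1 _) hdecay q S hS)
    (fun h hm S hS => card_competitive_le hκ hκ' hε hε1 rfl hδθ hgPm (fun _ _ => hg1 _) hdecay
      (F := fun v x => f (P v *ᵥ x)) (fun v => hPC _ (hP v))
      (fun v => hfm.comp (hPmp v).measurable) (fun v => hf2.comp_measurePreserving (hPmp v))
      (fun v => (hcomp v (hfm.pow_const 2)).trans hf1)
      (fun v => hfg.trans_eq (hcomp v (hfm.mul hgm)).symm) h hm S hS) ?_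
  calc 2 ^ y * (2 / τ ^ 2) + 2 / ((1 - κ) * ε / 2) ^ 2
      ≤ 2 ^ y * (2 * y ^ (2 * y)) + Λ * y ^ 2 := by gcongr
    _ ≤ ((p ^ D : ℕ) : ℝ) / 2 := two_rpow_mul_le_card_code hy4 (by linarith) hp9 hDge
    _ = _ := by simp [ZMod.card]
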